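/- **Model.** A radio network is a finite graph, directed or undirected (an undirected graph is a directed graph with symmetric edge relation), with $n$ nodes and a source $s$ from which every node is reachable; $D$ is the eccentricity of the source, i.e. the largest distance from $s$ to a node. Time is divided into synchronous steps. In each step every node either transmits a message or listens, and a listening node hears a message if and only if exactly one of its in-neighbours transmits; without collision detection, a listening node cannot distinguish between none and several of its in-neighbours transmitting, and a transmitting node hears nothing. Initially only $s$ knows the source message; all other nodes are inactive (do not transmit) until they hear a transmission. The network is blind: all nodes run the same randomized local algorithm, which is fixed before the network is given and has no information about the graph, $n$ or $D$ (a node knows only whether it is the source; nodes need no identifiers and no global clock). Write $\log x=\max\{\log_2x,1\}$. **Algorithm.** For $t=1,2,3,\dots$ perform an iteration of length $T=2^t$: the source draws independent uniform $S_1,\dots,S_T\in\{1,2\}$ and, independently for each $j\in\{1,\dots,T\}$ given $S_j$, a value $x_j\in\mathbb N\cup\{0\}$ from the distribution $Y_{S_j,T}$, and appends these, and the current step number, to the source message. In step $j$ of the iteration every active node, independently of the others, transmits what it holds with probability $2^{-x_j}$, and listens otherwise. The source is always active; another node becomes active when it hears a transmission, and becomes inactive again at the end of the iteration. Here, for a constant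 $c_1>0$, * (Shallow-Broadcast) $Y_{1,T}$ takes each integer value $y$ with $1\le y\le \sqrt T/c_1$ with probability $c_1/\sqrt T$, and the value $0$ with the remaining probability; * (General-Broadcast) $Y_{2,T}$ takes each integer value $y\ge1$ with probability $\frac1{3y\log^2y}$, and the value $0$ with the remaining probability. **Theorem.** There are constants $c_1,K,c>0$ and $n_0$ such that in every radio network without collision detection, directed or undirected, with $n\ge n_0$ nodes, a source from which all nodes are reachable, and source eccentricity $D$, the algorithm above performs broadcasting in $O\left(D\log\frac nD\,\log^2\log\frac nD+\log^2n\right)$ time with high probability: for every integer $$\tau\ \ge\ K\left(D\log\tfrac nD\,\bigl(\log\log\tfrac nD\bigr)^2+\log^2n\right),$$ the probability that some node does not know the source message after $\tau$ time-steps is at most $n^{-c}$. -/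

import Mathlib

open scoped NNReal ENNReal

noncomputable section

namespace RadioNetwork

/-! ### Probability mass functions -/

lemma tsum_prod_fin {α : Type*} (n : ℕ) (p : Fin n → α → ℝ≥0∞) :
    ∑' f : Fin n → α, ∏ i, p i (f i) = ∏ i, ∑' a, p i a := by
  induction n with
  | zero => simp [tsum_fintype]
  | succ n ih =>
    rw [← (Fin.consEquiv (fun _ : Fin (n + 1) => α)).tsum_eq,
      ENNReal.tsum_prod' (f := fun c => ∏ i, p i (Fin.consEquiv (fun _ : Fin (n + 1) => α) c i))]
    simp only [Fin.consEquiv, Equiv.coe_fn_mk, Fin.prod_univ_succ, Fin.cons_zero, Fin.cons_succ,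
      ENNReal.tsum_mul_left, ENNReal.tsum_mul_right, ih]

lemma tsum_prod_pi {ι α : Type*} [Fintype ι] (p : ι → α → ℝ≥0∞) :
    ∑' f : ι → α, ∏ i, p i (f i) = ∏ i, ∑' a, p i a := by
  let e := Fintype.equivFin ι
  rw [← (e.symm.prod_comp fun i => ∑' a, p i a), ← tsum_prod_fin,
    ← (e.arrowCongr (Equiv.refl α)).tsum_eq]
  refine tsum_congr fun f => ?_
  rw [← e.symm.prod_comp]
  simp [Equiv.arrowCongr]

/-- The joint law of independent random variables, the `i`-th of which has law `p i`. -/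
def independent {ι α : Type*} [Fintype ι] (p : ι → PMF α) : PMF (ι → α) :=
  ⟨fun f => ∏ i, p i (f i), by
    rw [Summable.hasSum_iff ENNReal.summable, tsum_prod_pi]
    simp [PMF.tsum_coe]⟩

/-- The law of a list of `k` independent samples of `p`. -/
def samples {α : Type*} (p : PMF α) : ℕ → PMF (List α)
  | 0 => PMF.pure []
  | k + 1 => p.bind fun a => (samples p k).map (a :: ·)

/-- The law on `ℕ` that takes each value `y ≥ 1` with probability `f y`, and the value `0` with
the remaining probability. -/
def withRemainder (f : ℕ → ℝ≥0∞) (hf : ∑' y, f (y + 1) ≤ 1) : PMF ℕ :=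
  ⟨fun y => if y = 0 then 1 - ∑' z, f (z + 1) else f y, by
    rw [Summable.hasSum_iff ENNReal.summable, tsum_eq_zero_add' ENNReal.summable]
    simpa using tsub_add_cancel_of_le hf⟩

/-- A coin that shows `true` with probability `p`. -/
def coin (p : ℝ≥0) (hp : p ≤ 1) : PMF Bool :=
  PMF.ofFintype (fun b => if b then (p : ℝ≥0∞) else ((1 - p : ℝ≥0) : ℝ≥0∞)) (by
    rw [Fintype.sum_bool, if_pos rfl, if_neg (by decide)]
    exact_mod_cast add_tsub_cancel_of_le hp)

/-! ### Networks

A network is a directed graph `G : Digraph V` on a finite type of nodes: `G.Adj u v` means that `u`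
can reach `v` by direct transmission. Undirected networks are those with a symmetric `G.Adj`. -/

/-- `Steps G k u v`: there is a directed walk with exactly `k` edges from `u` to `v`. -/
def Steps {V : Type} (G : Digraph V) : ℕ → V → V → Prop
  | 0, u, v => u = v
  | k + 1, u, v => ∃ w, Steps G k u w ∧ G.Adj w v

/-- Every node can be reached from `s` by a directed walk. -/
def AllReachable {V : Type} (G : Digraph V) (s : V) : Prop :=
  ∀ v, ∃ k, Steps G k s v

/-- The number of edges of a shortest directed walk from `u` to `v`. -/
def dist {V : Type} (G : Digraph V) (u v : V) : ℕ :=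
  sInf {k | Steps G k u v}

/-- The eccentricity of `s`: the largest distance from `s` to a node. -/
def eccentricity {V : Type} [Fintype V] (G : Digraph V) (s : V) : ℕ :=
  Finset.univ.sup fun v => dist G s v

open Classical in
/-- What node `v` hears in a time-step in which node `u` transmits `tx u` (`none` if `u` listens).
A listening node hears a message iff exactly one of its in-neighbours transmits; there is no
collision detection, so the outcomes "no in-neighbour transmits" and "several in-neighbours
transmit" are both `none`. A transmitting node hears nothing. -/
def heard {V Msg : Type} (G : Digraph V) (tx : V → Option Msg) (v : V) : Option Msg :=
  if h : tx v = none ∧ ∃! u, G.Adj u v ∧ (tx u).isSome then tx h.2.choose else none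

/-! ### Distributed randomized broadcasting algorithms without network knowledge

The algorithm is the same at all nodes (except that the source knows that it is the source and
holds the source message), it is fixed before the network, and a node's behaviour depends only on
its own state, that is, on its own random choices and on what it has heard. -/

/-- A blind randomized broadcasting algorithm, for source messages of type `M`. -/
structure BlindAlgorithm (M : Type) where
  /-- Local states of a node. -/
  State : Type
  /-- The messages that can be transmitted. -/
  Msg : Type
  /-- The initial state of the source, given the source message. -/
  start : M → State
  /-- The initial, inactive, state of all other nodes. -/
  idle : State
  /-- First half of a time-step: the node makes its random choices, updates its state, and either
  transmits a message or listens (`none`). -/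
  act : State → PMF (State × Option Msg)
  /-- Second half of a time-step: the node updates its state according to what it has heard. -/
  hear : State → Option Msg → State
  /-- The source message, once it is known to the node. -/
  learned : State → Option M
  /-- An inactive node does not transmit, -/
  idle_act : act idle = PMF.pure (idle, none)
  /-- and stays inactive until it hears a transmission. -/
  idle_hear : hear idle none = idle

namespace BlindAlgorithm

open Classical in
/-- The initial configuration, with source `s` and source message `m`. -/
def init {M V : Type} (A : BlindAlgorithm M) (s : V) (m : M) (v : V) : A.State :=
  if v = s then A.start m else A.idle

/-- The law of the next configuration: all nodes act, independently of each other, and then update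
their states according to what they hear. -/
def step {M V : Type} [Fintype V] (A : BlindAlgorithm M) (G : Digraph V) (σ : V → A.State) :
    PMF (V → A.State) :=
  (independent fun v => A.act (σ v)).map fun r v =>
    A.hear (r v).1 (heard G (fun u => (r u).2) v)

/-- The law of the configuration after `τ` time-steps. -/
def run {M V : Type} [Fintype V] (A : BlindAlgorithm M) (G : Digraph V) (s : V) (m : M) :
    ℕ → PMF (V → A.State)
  | 0 => PMF.pure (A.init s m)
  | τ + 1 => (run A G s m τ).bind (A.step G)

/-- The probability that after `τ` time-steps some node does not know the source message `m`. -/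
def failureProb {M V : Type} [Fintype V] (A : BlindAlgorithm M) (G : Digraph V) (s : V) (m : M)
    (τ : ℕ) : ℝ≥0∞ :=
  (A.run G s m τ).toOuterMeasure {σ | ¬ ∀ v, A.learned (σ v) = some m}

end BlindAlgorithm

/-! ### The broadcast framework -/

/-- A protocol for use in the framework. -/
structure Protocol where
  /-- The distribution from which the source draws the global random variable of a time-step,
  depending on the length `T` of the iteration. -/
  guess : ℕ → PMF ℕ
  /-- The transmission probability, depending on `T` and the global random variable. -/
  prob : ℕ → ℕ → ℝ≥0
  prob_le_one : ∀ T x, prob T x ≤ 1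

/-- What an active node knows, and transmits: the source message, the list
`(S_1, x_1), …, (S_T, x_T)` of the current iteration (whose length is `T`), and the number of
time-steps of this iteration that are already over. -/
structure Packet (C : ℕ) (M : Type) where
  payload : M
  schedule : List (Fin C × ℕ)
  pos : ℕ

/-- Move on to the next time-step of the iteration; `none` when the iteration is over. -/
def Packet.next {C : ℕ} {M : Type} (p : Packet C M) : Option (Packet C M) :=
  if p.pos + 1 < p.schedule.length then some { p with pos := p.pos + 1 } else none

/-- The state of a node in the framework. A node is active if `packet` is not `none`. -/
structure NodeState (C : ℕ) (M : Type) where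
  /-- At the source: the source message, and the number of iterations started so far. -/
  source : Option (M × ℕ)
  /-- The source message, if the node has ever been informed of it. -/
  known : Option M
  packet : Option (Packet C M)

namespace Framework

/-- The law of the pair `(S_j, x_j)`: a uniformly chosen protocol, and a sample of its distribution
for iterations of length `T`. -/
def entry {C : ℕ} [NeZero C] (P : Fin C → Protocol) (T : ℕ) : PMF (Fin C × ℕ) :=
  (PMF.uniformOfFintype (Fin C)).bind fun i => ((P i).guess T).map fun x => (i, x)

/-- At the beginning of an iteration (the source holds no packet) the source, which has started
`t` iterations so far, draws the `T = 2 ^ (t + 1)` pairs `(S_j, x_j)` of iteration `t + 1`. In all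
other cases nothing happens. -/
def prepare {C : ℕ} [NeZero C] (P : Fin C → Protocol) {M : Type} (σ : NodeState C M) :
    PMF (NodeState C M) :=
  match σ.source, σ.packet with
  | some (m, t), none =>
      (samples (entry P (2 ^ (t + 1))) (2 ^ (t + 1))).map fun l =>
        { σ with source := some (m, t + 1), packet := some ⟨m, l, 0⟩ }
  | _, _ => PMF.pure σ

/-- The probability with which the holder of a packet transmits in the current time-step. -/
def transmitProb {C : ℕ} (P : Fin C → Protocol) {M : Type} (p : Packet C M) : ℝ≥0 :=
  match p.schedule[p.pos]? with
  | some (i, x) => (P i).prob p.schedule.length x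
  | none => 0

lemma transmitProb_le_one {C : ℕ} (P : Fin C → Protocol) {M : Type} (p : Packet C M) :
    transmitProb P p ≤ 1 := by
  unfold transmitProb
  split
  · exact (P _).prob_le_one _ _
  · exact zero_le_one

/-- Active nodes transmit their packet with the prescribed probability; others listen. -/
def act {C : ℕ} [NeZero C] (P : Fin C → Protocol) {M : Type} (σ : NodeState C M) :
    PMF (NodeState C M × Option (Packet C M)) :=
  (prepare P σ).bind fun σ' =>
    match σ'.packet with
    | none => PMF.pure (σ', none)
    | some p => (coin (transmitProb P p) (transmitProb_le_one P p)).map fun b =>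
        (σ', if b then some p else none)

/-- An inactive node that hears a packet becomes active. Active nodes move on to the next
time-step, and become inactive at the end of the iteration. -/
def hear {C : ℕ} {M : Type} (σ : NodeState C M) (h : Option (Packet C M)) :
     NodeState C M where
  source := σ.source
  known := σ.known.or (h.map Packet.payload)
  packet := (σ.packet.or h).bind Packet.next

end Framework

/-- The broadcast framework: for `t = 1, 2, …`, an iteration of length `T = 2 ^ t`, in which the
source draws independent uniform `S_j ∈ [C]` and independent `x_j` from the distribution of
protocol `S_j` and appends them to the source message, and in time-step `j` of which the active
nodes transmit independently with the probability that protocol `S_j` prescribes for `T` and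
`x_j`. At the end of the iteration all nodes but the source become inactive. -/
def framework {C : ℕ} [NeZero C] (P : Fin C → Protocol) (M : Type) : BlindAlgorithm M where
  State := NodeState C M
  Msg := Packet C M
  start m := ⟨some (m, 0), some m, none⟩
  idle := ⟨none, none, none⟩
  act := Framework.act P
  hear := Framework.hear
  learned := NodeState.known
  idle_act := by simp [Framework.act, Framework.prepare]
  idle_hear := by simp [Framework.hear]

/-! ### The two protocols -/

/-- `log x` means `max (log₂ x) 1`. -/
def log (x : ℝ) : ℝ := max (Real.logb 2 x) 1

/-- The probability of `y` in Shallow-Broadcast: `c / √T` for `1 ≤ y ≤ √T / c`. -/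
def shallowWeight (c : ℝ) (T y : ℕ) : ℝ≥0∞ :=
  if 1 ≤ y ∧ y ≤ ⌊√T / c⌋₊ then ENNReal.ofReal (c / √T) else 0

lemma tsum_shallowWeight_le (c : ℝ) (T : ℕ) : ∑' y, shallowWeight c T (y + 1) ≤ 1 := by
  have h0 : ∀ y ∉ Finset.range ⌊√T / c⌋₊, shallowWeight c T (y + 1) = 0 := by
    intro y hy
    rw [Finset.mem_range] at hy
    exact if_neg (by omega)
  rw [tsum_eq_sum h0]
  calc ∑ y ∈ Finset.range ⌊√T / c⌋₊, shallowWeight c T (y + 1)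
      ≤ ∑ y ∈ Finset.range ⌊√T / c⌋₊, ENNReal.ofReal (c / √T) := by
        refine Finset.sum_le_sum fun y _ => ?_
        unfold shallowWeight
        split <;> simp
    _ = ENNReal.ofReal (⌊√T / c⌋₊ * (c / √T)) := by
        rw [Finset.sum_const, Finset.card_range, nsmul_eq_mul,
          ENNReal.ofReal_mul (Nat.cast_nonneg _), ENNReal.ofReal_natCast]
    _ ≤ 1 := by
        rw [ENNReal.ofReal_le_one]
        rcases le_or_gt (√T / c) 0 with h | h
        · simp [Nat.floor_of_nonpos h]
        · calc (⌊√T / c⌋₊ : ℝ) * (c / √T) ≤ (√T / c) * (c / √T) := by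
                refine mul_le_mul_of_nonneg_right (Nat.floor_le h.le) ?_
                rw [← inv_div]
                exact (inv_pos.2 h).le
            _ ≤ 1 := by
                rw [← inv_div (√T : ℝ) c]
                exact (mul_inv_cancel₀ h.ne').le

/-- Shallow-Broadcast with constant `c`. -/
def shallowBroadcast (c : ℝ) : Protocol where
  guess T := withRemainder (shallowWeight c T) (tsum_shallowWeight_le c T)
  prob _ x := (1 / 2) ^ x
  prob_le_one _ _ := pow_le_one' (by norm_num) _

/-- The probability of `y ≥ 1` in General-Broadcast. -/
def generalWeight (y : ℕ) : ℝ≥0∞ := ENNReal.ofReal (1 / (3 * y * log y ^ 2))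

lemma generalWeight_sum_le (k : ℕ) :
    ∑ y ∈ Finset.Ico (1 : ℕ) (2 ^ (k + 2)), (1 / (3 * (y : ℝ) * log y ^ 2)) ≤
      1 - 1 / (3 * ((k : ℝ) + 1)) := by
  have hlog : ∀ x : ℝ, 1 ≤ log x := fun x => le_max_right _ _
  induction k with
  | zero =>
    have h : Finset.Ico (1 : ℕ) (2 ^ (0 + 2)) = {1, 2, 3} := by decide
    have key : ∀ y : ℝ, 0 < y → 1 / (3 * y * log y ^ 2) ≤ 1 / (3 * y) := by
      intro y hy
      refine one_div_le_one_div_of_le (by positivity) ?_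
      exact le_mul_of_one_le_right (by positivity) (one_le_pow₀ (hlog y))
    rw [h, Finset.sum_insert (by decide), Finset.sum_insert (by decide), Finset.sum_singleton]
    have h1 := (key 1 (by norm_num)).trans_eq (by norm_num : 1 / (3 * (1 : ℝ)) = 1 / 3)
    have h2 := (key 2 (by norm_num)).trans_eq (by norm_num : 1 / (3 * (2 : ℝ)) = 1 / 6)
    have h3 := (key 3 (by norm_num)).trans_eq (by norm_num : 1 / (3 * (3 : ℝ)) = 1 / 9)
    have h4 : (1 : ℝ) - 1 / (3 * (((0 : ℕ) : ℝ) + 1)) = 2 / 3 := by norm_num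
    rw [h4, Nat.cast_one, Nat.cast_ofNat, Nat.cast_ofNat]
    linarith
  | succ k ih =>
    rw [← Finset.sum_Ico_consecutive _ Nat.one_le_two_pow
      (Nat.pow_le_pow_right (by norm_num : 0 < 2) (by omega : k + 2 ≤ k + 1 + 2))]
    have hb : ∑ y ∈ Finset.Ico ((2 : ℕ) ^ (k + 2)) (2 ^ (k + 1 + 2)), (1 / (3 * (y : ℝ) * log y ^ 2)) ≤
        1 / (3 * ((k : ℝ) + 2) ^ 2) := by
      have hterm : ∀ y ∈ Finset.Ico ((2 : ℕ) ^ (k + 2)) (2 ^ (k + 1 + 2)),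
          (1 / (3 * (y : ℝ) * log y ^ 2)) ≤ 1 / (3 * 2 ^ (k + 2) * ((k : ℝ) + 2) ^ 2) := by
        intro y hy
        have hy' : (2 : ℝ) ^ (k + 2) ≤ y := by exact_mod_cast (Finset.mem_Ico.1 hy).1
        have hl : (k : ℝ) + 2 ≤ log y := by
          refine le_trans ?_ (le_max_left _ _)
          rw [Real.le_logb_iff_rpow_le (by norm_num) (lt_of_lt_of_le (by positivity) hy')]
          calc (2 : ℝ) ^ ((k : ℝ) + 2) = 2 ^ (k + 2) := by
                rw [← Real.rpow_natCast]; push_cast; rfl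
            _ ≤ y := hy'
        gcongr
      refine (Finset.sum_le_sum hterm).trans (le_of_eq ?_)
      have hc : 2 ^ (k + 1 + 2) - 2 ^ (k + 2) = 2 ^ (k + 2) := by
        rw [show k + 1 + 2 = (k + 2) + 1 by ring, pow_succ]; omega
      rw [Finset.sum_const, Nat.card_Ico, hc, nsmul_eq_mul]
      push_cast
      field_simp
    have hk : 1 / (3 * ((k : ℝ) + 2) ^ 2) ≤ 1 / (3 * (k + 1)) - 1 / (3 * (k + 2)) := by
      have : 1 / (3 * ((k : ℝ) + 1)) - 1 / (3 * (k + 2)) = 1 / (3 * ((k + 1) * (k + 2))) := by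
        field_simp; ring
      rw [this]
      refine one_div_le_one_div_of_le (by positivity) ?_
      nlinarith [(Nat.cast_nonneg k : (0 : ℝ) ≤ k)]
    have e : ((k + 1 : ℕ) : ℝ) + 1 = k + 2 := by push_cast; ring
    rw [e]
    linarith

lemma tsum_generalWeight_le : ∑' y, generalWeight (y + 1) ≤ 1 := by
  have hpos : ∀ y : ℕ, 0 ≤ 1 / (3 * (y : ℝ) * log y ^ 2) := fun y => by positivity
  refine ENNReal.tsum_le_of_sum_range_le fun n => ?_
  unfold generalWeight
  rw [← ENNReal.ofReal_sum_of_nonneg fun y _ => hpos (y + 1), ENNReal.ofReal_le_one]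
  have h := Finset.sum_Ico_eq_sum_range (fun y : ℕ => 1 / (3 * (y : ℝ) * log y ^ 2)) 1 (n + 1)
  simp only [add_tsub_cancel_right, add_comm 1] at h
  rw [← h]
  refine (Finset.sum_le_sum_of_subset_of_nonneg ?_ fun y _ _ => hpos y).trans
    ((generalWeight_sum_le n).trans (sub_le_self _ (by positivity)))
  refine Finset.Ico_subset_Ico_right ?_
  have := (Nat.lt_two_pow_self (n := n + 2))
  omega

/-- General-Broadcast. -/
def generalBroadcast : Protocol where
  guess _ := withRemainder generalWeight tsum_generalWeight_le
  prob _ x := (1 / 2) ^ x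
  prob_le_one _ _ := pow_le_one' (by norm_num) _

/-- The framework with Shallow-Broadcast (with constant `c`) and General-Broadcast. -/
def broadcast (c : ℝ) (M : Type) : BlindAlgorithm M :=
  framework ![shallowBroadcast c, generalBroadcast] M

/-- `D log (n / D) log² log (n / D) + log² n`. -/
def timeBound (n D : ℕ) : ℝ :=
  D * log (n / D) * log (log (n / D)) ^ 2 + log n ^ 2

end RadioNetwork

end

/-!
The source draws the whole schedule of an iteration in advance, without looking at the network, so
after averaging over the schedule the set of active nodes performs a Markov chain. Fix a shortest
walk `w` from the source to a node. The front of an active set is the last position of the walk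
with an active in-neighbour. A node that is adjacent to several positions of the walk competes only
at the last of them, so the numbers `m i` of nodes that can compete at position `i` add up to at
most `n`. If the node at position `i`, once it is the front, is informed with probability at least
`p i`, and `r ≤ x i * p i` for some `x i ≤ 1 / 2`, then the product of `(1 - x j)⁻¹` over the
positions `j` not passed by the front contracts by the factor `1 - r` in expectation. After `T`
steps the end of the walk is thus uninformed with probability at most
`exp (2 * ∑ i, x i - r * T)`.

Shallow-Broadcast guarantees `p i` of order `1 / √T`. With `x i = 1 / 2` this suffices if the
eccentricity `D` is at most a small multiple of `√T`. General-Broadcast guarantees `p i` of order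
`1 / cost (m i)`, where `cost x = log x * log (log x) ^ 2`. With `x i = cost (m i) / (2 * cost n)`
this suffices if `D` is larger, because `∑ i, cost (m i)` is of order `D * cost (n / D)`. In both
cases `T` has to be of order `timeBound n D`, and an iteration of length at least `τ / 4` is
completed within the first `τ` time-steps.
-/

noncomputable section

namespace RadioNetwork

/-! ### Expectations -/

/-- The expectation of a nonnegative function. -/
def expect {α : Type*} (p : PMF α) (F : α → ℝ≥0∞) : ℝ≥0∞ := ∑' a, p a * F a

section expect

variable {α β ι : Type*}

lemma expect_pure (a : α) (F : α → ℝ≥0∞) : expect (PMF.pure a) F = F a := by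
  rw [expect, tsum_eq_single a fun b hb => by simp [PMF.pure_apply, hb]]
  simp

lemma expect_bind (p : PMF α) (f : α → PMF β) (F : β → ℝ≥0∞) :
    expect (p.bind f) F = expect p fun a => expect (f a) F := by
  simp only [expect, PMF.bind_apply, ← ENNReal.tsum_mul_right, ← ENNReal.tsum_mul_left]
  rw [ENNReal.tsum_comm]
  simp only [mul_assoc]

lemma expect_map (p : PMF α) (f : α → β) (F : β → ℝ≥0∞) :
    expect (p.map f) F = expect p fun a => F (f a) := by
  simp only [PMF.map, expect_bind, Function.comp_apply, expect_pure]

lemma expect_mono_of_mem_support {p : PMF α} {F F' : α → ℝ≥0∞}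
    (h : ∀ a ∈ p.support, F a ≤ F' a) : expect p F ≤ expect p F' := by
  refine ENNReal.tsum_le_tsum fun a => ?_
  by_cases ha : p a = 0
  · simp [ha]
  · exact mul_le_mul_right (h a ((PMF.mem_support_iff _ _).2 ha)) _

lemma expect_mono {p : PMF α} {F F' : α → ℝ≥0∞} (h : ∀ a, F a ≤ F' a) :
    expect p F ≤ expect p F' :=
  expect_mono_of_mem_support fun a _ => h a

lemma expect_const (p : PMF α) (c : ℝ≥0∞) : expect p (fun _ => c) = c := by
  simp [expect, ENNReal.tsum_mul_right]

lemma expect_le_of_forall_mem_support {p : PMF α} {F : α → ℝ≥0∞} {c : ℝ≥0∞}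
    (h : ∀ a ∈ p.support, F a ≤ c) : expect p F ≤ c :=
  (expect_mono_of_mem_support h).trans_eq (expect_const p c)

lemma expect_add (p : PMF α) (F F' : α → ℝ≥0∞) :
    expect p (fun a => F a + F' a) = expect p F + expect p F' := by
  simp only [expect, mul_add, ENNReal.tsum_add]

lemma expect_const_mul (p : PMF α) (c : ℝ≥0∞) (F : α → ℝ≥0∞) :
    expect p (fun a => c * F a) = c * expect p F := by
  simp only [expect, ← ENNReal.tsum_mul_left, mul_left_comm]

lemma expect_finset_sum (p : PMF α) (s : Finset ι) (F : ι → α → ℝ≥0∞) :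
    expect p (fun a => ∑ i ∈ s, F i a) = ∑ i ∈ s, expect p (F i) := by
  simp only [expect, Finset.mul_sum]
  exact Summable.tsum_finsetSum fun _ _ => ENNReal.summable

lemma mul_le_expect (p : PMF α) (F : α → ℝ≥0∞) (a : α) : p a * F a ≤ expect p F :=
  ENNReal.le_tsum a

lemma expect_indicator (p : PMF α) (s : Set α) :
    expect p (s.indicator 1) = p.toOuterMeasure s := by
  rw [PMF.toOuterMeasure_apply]
  refine tsum_congr fun a => ?_
  by_cases h : a ∈ s <;> simp [h]

lemma toOuterMeasure_bind (p : PMF α) (f : α → PMF β) (s : Set β) :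
    (p.bind f).toOuterMeasure s = expect p fun a => (f a).toOuterMeasure s := by
  simp only [← expect_indicator, expect_bind]

lemma toOuterMeasure_le_one (p : PMF α) (s : Set α) : p.toOuterMeasure s ≤ 1 :=
  (expect_indicator p s).symm.trans_le <|
    expect_le_of_forall_mem_support fun a _ => Set.indicator_le_self' (fun _ _ => zero_le) a

lemma expect_independent_prod [Fintype ι] (p : ι → PMF α) (F : ι → α → ℝ≥0∞) :
    expect (independent p) (fun f => ∏ i, F i (f i)) = ∏ i, expect (p i) (F i) := by
  simp only [expect, ← tsum_prod_pi, Finset.prod_mul_distrib]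
  rfl

lemma independent_map [Fintype ι] (p : ι → PMF α) (f : ι → α → β) :
    independent (fun i => (p i).map (f i)) = (independent p).map fun g i => f i (g i) := by
  classical
  ext g
  change ∏ i, (p i).map (f i) (g i) = _
  simp only [PMF.map_apply]
  rw [← tsum_prod_pi]
  refine tsum_congr fun h => ?_
  rw [Finset.prod_ite_zero]
  simp only [Finset.mem_univ, forall_const, funext_iff]
  rfl

lemma independent_update_bind [Fintype ι] [DecidableEq ι] (p : ι → PMF α) (i : ι) (q : PMF β)
    (f : β → PMF α) :
    independent (Function.update p i (q.bind f)) =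
      q.bind fun b => independent (Function.update p i (f b)) := by
  ext g
  have update_apply (r : PMF α) : independent (Function.update p i r) g =
      r (g i) * ∏ j ∈ Finset.univ.erase i, p j (g j) := by
    change ∏ j, Function.update p i r j (g j) = _
    rw [← Finset.mul_prod_erase _ _ (Finset.mem_univ i), Function.update_self]
    congr 1
    refine Finset.prod_congr rfl fun j hj => ?_
    rw [Function.update_of_ne (Finset.ne_of_mem_erase hj)]
  rw [update_apply, PMF.bind_apply, PMF.bind_apply, ← ENNReal.tsum_mul_right]
  simp only [update_apply, mul_assoc]

lemma mem_support_of_mem_support_independent [Fintype ι] {p : ι → PMF α} {f : ι → α}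
    (hf : f ∈ (independent p).support) (i : ι) : f i ∈ (p i).support :=
  (PMF.mem_support_iff _ _).2 <|
    Finset.prod_ne_zero_iff.1 ((PMF.mem_support_iff _ _).1 hf) i (Finset.mem_univ i)

lemma length_of_mem_support_samples (p : PMF α) :
    ∀ {k : ℕ} {l : List α}, l ∈ (samples p k).support → l.length = k
  | 0, l, h => by simpa [samples] using h
  | k + 1, l, h => by
    simp only [samples, PMF.mem_support_bind_iff, PMF.mem_support_map_iff] at h
    obtain ⟨a, -, l', hl', rfl⟩ := h
    rw [List.length_cons, length_of_mem_support_samples p hl']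

end expect

/-! ### Markov chains -/

/-- The law of the state of a Markov chain with transition law `κ`, `k` steps after it was in a
given state. -/
def chain {α : Type*} (κ : α → PMF α) : ℕ → α → PMF α
  | 0, a => PMF.pure a
  | k + 1, a => (κ a).bind (chain κ k)

section chain

variable {α : Type*} {κ : α → PMF α} {S : Set α}

lemma chain_add (κ : α → PMF α) :
    ∀ (j k : ℕ) (a : α), chain κ (j + k) a = (chain κ j a).bind (chain κ k)
  | 0, k, a => by rw [zero_add, chain, PMF.pure_bind]
  | j + 1, k, a => by
    rw [Nat.succ_add, chain, chain, PMF.bind_bind]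
    exact congrArg _ (funext fun b => chain_add κ j k b)

lemma chain_succ (κ : α → PMF α) (k : ℕ) (a : α) :
    chain κ (k + 1) a = (chain κ k a).bind κ := by
  have chain_one : chain κ 1 = κ := funext fun _ => PMF.bind_pure _
  rw [chain_add, chain_one]

lemma expect_chain_le {F : α → ℝ≥0∞} {c : ℝ≥0∞} (hS : ∀ a ∈ S, (κ a).support ⊆ S)
    (hF : ∀ a ∈ S, expect (κ a) F ≤ c * F a) :
    ∀ (k : ℕ) {a : α}, a ∈ S → expect (chain κ k a) F ≤ c ^ k * F a
  | 0, a, _ => by rw [chain, expect_pure, pow_zero, one_mul]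
  | k + 1, a, ha => by
    calc expect (chain κ (k + 1) a) F = expect (κ a) fun b => expect (chain κ k b) F := by
          rw [chain, expect_bind]
      _ ≤ expect (κ a) fun b => c ^ k * F b :=
          expect_mono_of_mem_support fun b hb => expect_chain_le hS hF k (hS a ha hb)
      _ = c ^ k * expect (κ a) F := expect_const_mul _ _ _
      _ ≤ c ^ k * (c * F a) := mul_le_mul_right (hF a ha) _
      _ = c ^ (k + 1) * F a := by ring

lemma antitone_toOuterMeasure_chain_compl (hS : ∀ a ∈ S, (κ a).support ⊆ S) (a : α) :
    Antitone fun k => (chain κ k a).toOuterMeasure Sᶜ := by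
  refine antitone_nat_of_succ_le fun k => ?_
  rw [chain_succ, toOuterMeasure_bind, ← expect_indicator]
  refine expect_mono fun b => ?_
  by_cases hb : b ∈ S
  · rw [(PMF.toOuterMeasure_apply_eq_zero_iff _ _).2
      (Set.disjoint_compl_right_iff_subset.2 (hS b hb))]
    exact zero_le
  · rw [Set.indicator_of_mem hb]
    exact toOuterMeasure_le_one _ _

end chain

/-! ### Independent coins -/

section coin

variable {V : Type*} [Fintype V]

lemma expect_coin (p : ℝ≥0) (hp : p ≤ 1) (F : Bool → ℝ≥0∞) :
    expect (coin p hp) F = p * F true + ((1 - p : ℝ≥0) : ℝ≥0∞) * F false := by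
  simp [expect, coin]

open Classical in
lemma ite_existsUnique_eq_sum (N : Finset V) (b : V → Bool) :
    (if ∃! u, u ∈ N ∧ b u = true then 1 else 0 : ℝ≥0∞) =
      ∑ u ∈ N, ∏ w, if w ∈ N → (b w = true ↔ w = u) then 1 else 0 := by
  simp only [Finset.prod_boole, Finset.mem_univ, forall_const]
  split_ifs with h
  · obtain ⟨u, ⟨hu, hbu⟩, huniq⟩ := h
    rw [Finset.sum_eq_single_of_mem u hu, if_pos]
    · exact fun w hw => ⟨fun hb => huniq w ⟨hw, hb⟩, fun h => h ▸ hbu⟩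
    · exact fun u' _ hne => if_neg fun h => hne ((h u hu).1 hbu).symm
  · rw [Finset.sum_eq_zero fun u hu => if_neg fun h' => h ?_]
    exact ⟨u, ⟨hu, (h' u hu).2 rfl⟩, fun w hw => (h' w hw.1).1 hw.2⟩

open Classical in
lemma toOuterMeasure_coin_existsUnique (p : V → ℝ≥0) (hp : ∀ v, p v ≤ 1) (N : Finset V) :
    (independent fun v => coin (p v) (hp v)).toOuterMeasure {b | ∃! u, u ∈ N ∧ b u = true} =
      (∑ u ∈ N, p u * ∏ w ∈ N.erase u, (1 - p w) : ℝ≥0) := by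
  have indicator_eq : {b : V → Bool | ∃! u, u ∈ N ∧ b u = true}.indicator 1 =
      fun b => ∑ u ∈ N, ∏ w, if w ∈ N → (b w = true ↔ w = u) then (1 : ℝ≥0∞) else 0 :=
    funext fun b => ite_existsUnique_eq_sum N b
  rw [← expect_indicator, indicator_eq, expect_finset_sum, ENNReal.ofNNReal_finsetSum]
  refine Finset.sum_congr rfl fun u hu => ?_
  have expect_factor (w : V) :
      expect (coin (p w) (hp w)) (fun c => if w ∈ N → (c = true ↔ w = u) then 1 else 0) =
        if w ∈ N then if w = u then (p w : ℝ≥0∞) else ((1 - p w : ℝ≥0) : ℝ≥0∞) else 1 := by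
    by_cases hw : w ∈ N
    · by_cases hwu : w = u <;> simp [expect_coin, hw, hwu, hu]
    · simp [hw, expect_const]
  rw [expect_independent_prod (F := fun w c => if w ∈ N → (c = true ↔ w = u) then 1 else 0)]
  simp only [expect_factor]
  rw [Finset.prod_ite_mem, Finset.univ_inter, ← Finset.mul_prod_erase _ _ hu, if_pos rfl,
    Finset.prod_congr rfl fun w hw => if_neg (Finset.ne_of_mem_erase hw)]
  push_cast
  rfl

end coin

/-! ### The spread of the active set -/

section spread

variable {V E : Type} (G : Digraph V)

/-- The active nodes after a time-step in which the nodes in `A` are active, and those of them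
whose coins show `true` transmit. -/
def spread (A : Set V) (b : V → Bool) : Set V :=
  A ∪ {v | ∃! u, G.Adj u v ∧ u ∈ A ∧ b u = true}

/-- The law of the next active set, if the coins have the joint law `μ`. -/
def spreadLaw (μ : PMF (V → Bool)) (A : Set V) : PMF (Set V) := μ.map (spread G A)

/-- The law of the active set after time-steps with the given schedule entries, if the coins in a
time-step with entry `e` have the joint law `χ e`. -/
def activeLaw (χ : E → PMF (V → Bool)) : List E → Set V → PMF (Set V)
  | [], A => PMF.pure A
  | e :: l, A => (spreadLaw G (χ e) A).bind (activeLaw χ l)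

variable {G}

lemma subset_spread (A : Set V) (b : V → Bool) : A ⊆ spread G A b := Set.subset_union_left

lemma support_spreadLaw_subset (μ : PMF (V → Bool)) (s : V) {A : Set V} (hA : s ∈ A) :
    (spreadLaw G μ A).support ⊆ {B | s ∈ B} := by
  rw [spreadLaw, PMF.support_map, Set.image_subset_iff]
  exact fun b _ => subset_spread A b hA

/-- The schedule is drawn independently of the course of the iteration, so it may be drawn entry by
entry, which turns the active set into a Markov chain. -/
lemma samples_bind_activeLaw (ε : PMF E) (χ : E → PMF (V → Bool)) :
    ∀ (k : ℕ) (A : Set V), ((samples ε k).bind fun l => activeLaw G χ l A) =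
      chain (spreadLaw G (ε.bind χ)) k A
  | 0, A => by rw [samples, PMF.pure_bind, activeLaw, chain]
  | k + 1, A => by
    calc ((samples ε (k + 1)).bind fun l => activeLaw G χ l A)
        = ε.bind fun e => (samples ε k).bind fun l =>
            (spreadLaw G (χ e) A).bind (activeLaw G χ l) := by
          rw [samples, PMF.bind_bind]
          simp only [PMF.bind_map]
          rfl
      _ = ε.bind fun e => (spreadLaw G (χ e) A).bind fun B => (samples ε k).bind fun l =>
            activeLaw G χ l B := by
          simp only [PMF.bind_comm (samples ε k)]
      _ = ε.bind fun e => (spreadLaw G (χ e) A).bind (chain (spreadLaw G (ε.bind χ)) k) := by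
          simp only [samples_bind_activeLaw ε χ k]
      _ = chain (spreadLaw G (ε.bind χ)) (k + 1) A := by
          rw [chain, spreadLaw, PMF.map_bind, PMF.bind_bind]
          rfl

end spread

/-! ### Runs as Markov chains -/

section BlindAlgorithm

variable {M V : Type} [Fintype V] (A : BlindAlgorithm M) (G : Digraph V) (s : V) (m : M)

lemma run_eq_chain : ∀ τ, A.run G s m τ = chain (A.step G) τ (A.init s m)
  | 0 => rfl
  | τ + 1 => by rw [BlindAlgorithm.run, run_eq_chain τ, chain_succ]

lemma failureProb_eq_chain (τ : ℕ) : A.failureProb G s m τ =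
    (chain (A.step G) τ (A.init s m)).toOuterMeasure {σ | ∀ v, A.learned (σ v) = some m}ᶜ := by
  rw [BlindAlgorithm.failureProb, run_eq_chain]
  rfl

end BlindAlgorithm

/-! ### Configurations of the framework -/

open Classical in
lemma heard_ite {V Msg : Type} (G : Digraph V) (q : V → Prop) [DecidablePred q] (x : Msg)
    (v : V) : heard G (fun u => if q u then some x else none) v =
      if ¬q v ∧ ∃! u, G.Adj u v ∧ q u then some x else none := by
  have isSome_iff (u : V) : (if q u then some x else none).isSome ↔ q u := by simp
  have eq_none_iff : (if q v then some x else none) = none ↔ ¬q v := by simp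
  simp only [heard, isSome_iff, eq_none_iff]
  by_cases h : ¬q v ∧ ∃! u, G.Adj u v ∧ q u
  · rw [dif_pos h, if_pos h]
    exact if_pos h.2.choose_spec.1.2
  · rw [dif_neg h, if_neg h]

namespace Framework

variable {C : ℕ} {M V : Type}

open Classical in
/-- A configuration in which the source has started `t` iterations, and in which every node knows
either nothing or the source message `m`. -/
structure Consistent (s : V) (m : M) (t : ℕ) (σ : V → NodeState C M) : Prop where
  source : ∀ v, (σ v).source = if v = s then some (m, t) else none
  known : ∀ v, (σ v).known = none ∨ (σ v).known = some m

/-- A configuration at the beginning of iteration `t + 1`. -/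
structure AtStart (s : V) (m : M) (t : ℕ) (σ : V → NodeState C M) : Prop
    extends Consistent s m t σ where
  known_source : (σ s).known = some m
  packet : ∀ v, (σ v).packet = none

open Classical in
/-- A configuration `j` time-steps after the beginning of iteration `t`, where `l` is the schedule
of the iteration and `A` is the set of active nodes. At the end of the iteration, `j = l.length`,
the set `A` still records the nodes that were active, although no node holds a packet any more. -/
structure During (s : V) (m : M) (t : ℕ) (l : List (Fin C × ℕ)) (j : ℕ) (A : Set V)
    (σ : V → NodeState C M) : Prop extends Consistent s m t σ where
  mem_source : s ∈ A
  known_of_mem : ∀ v ∈ A, (σ v).known = some m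
  packet : ∀ v, (σ v).packet = if v ∈ A ∧ j < l.length then some ⟨m, l, j⟩ else none

/-- The next configuration, if exactly those holders of a packet transmit whose coins show
`true`. -/
def advance (G : Digraph V) (σ : V → NodeState C M) (b : V → Bool) (v : V) : NodeState C M :=
  hear (σ v) (heard G (fun u => if b u then (σ u).packet else none) v)

open Classical in
/-- The configuration after the source has drawn the schedule `l` of iteration `t + 1`. -/
def load (s : V) (m : M) (t : ℕ) (σ : V → NodeState C M) (l : List (Fin C × ℕ)) :
    V → NodeState C M :=
  Function.update σ s { σ s with source := some (m, t + 1), packet := some ⟨m, l, 0⟩ }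

section

variable {s : V} {m : M} {t j : ℕ} {l : List (Fin C × ℕ)} {A : Set V} {σ : V → NodeState C M}

lemma During.atStart (h : During s m t l l.length A σ) : AtStart s m t σ where
  toConsistent := h.toConsistent
  known_source := h.known_of_mem s h.mem_source
  packet v := by simp [h.packet]

open Classical in
lemma During.heard_eq (G : Digraph V) (h : During s m t l j A σ) (hj : j < l.length)
    (b : V → Bool) (v : V) :
    heard G (fun u => if b u then (σ u).packet else none) v =
      if ¬(v ∈ A ∧ b v = true) ∧ ∃! u, G.Adj u v ∧ u ∈ A ∧ b u = true then some ⟨m, l, j⟩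
      else none := by
  have transmitted (u : V) : (if b u then (σ u).packet else none) =
      if u ∈ A ∧ b u = true then some ⟨m, l, j⟩ else none := by
    by_cases hb : b u = true <;> simp [h.packet, hb, hj]
  simp only [transmitted]
  exact heard_ite G (fun u => u ∈ A ∧ b u = true) _ v

open Classical in
lemma During.heard_eq_of_notMem (G : Digraph V) (h : During s m t l j A σ) (hj : j < l.length)
    (b : V → Bool) {v : V} (hv : v ∉ A) :
    heard G (fun u => if b u then (σ u).packet else none) v =
      if v ∈ spread G A b then some ⟨m, l, j⟩ else none := by
  rw [h.heard_eq G hj]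
  exact if_congr (by simp [spread, hv]) rfl rfl

lemma During.advance {G : Digraph V} (h : During s m t l j A σ) (hj : j < l.length)
    (b : V → Bool) : During s m t l (j + 1) (spread G A b) (advance G σ b) where
  source := h.source
  known v := by
    simp only [Framework.advance, hear, h.heard_eq G hj]
    rcases h.known v with hk | hk <;> split_ifs <;> simp [hk]
  mem_source := subset_spread A b h.mem_source
  known_of_mem v hv := by
    by_cases hA : v ∈ A
    · simp [Framework.advance, hear, h.known_of_mem v hA]
    · rw [Framework.advance, hear, h.heard_eq_of_notMem G hj b hA, if_pos hv]
      rcases h.known v with hk | hk <;> simp [hk]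
  packet v := by
    by_cases hA : v ∈ A
    · simp [Framework.advance, hear, h.packet, hA, subset_spread A b hA, hj, Packet.next]
    · rw [Framework.advance, hear, h.heard_eq_of_notMem G hj b hA, h.packet]
      by_cases hs : v ∈ spread G A b <;> simp [hA, hs, Packet.next]

lemma AtStart.during_load (h : AtStart s m t σ) (hl : 0 < l.length) :
    During s m (t + 1) l 0 {s} (load s m t σ l) where
  source v := by
    by_cases hv : v = s
    · simp [load, hv]
    · simp [load, hv, h.source]
  known v := by
    by_cases hv : v = s
    · simp [load, hv, h.known_source]
    · simpa [load, hv] using h.known v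
  mem_source := rfl
  known_of_mem v hv := by
    obtain rfl : v = s := hv
    simpa [load] using h.known_source
  packet v := by
    by_cases hv : v = s
    · simp [load, hv, hl]
    · simp [load, hv, h.packet]

variable [NeZero C]

lemma prepare_eq_pure {P : Fin C → Protocol} {σ : NodeState C M}
    (h : σ.source = none ∨ σ.packet ≠ none) : prepare P σ = PMF.pure σ := by
  unfold prepare
  split
  · simp_all
  · rfl

lemma known_eq_of_mem_support_act {P : Fin C → Protocol} {σ : NodeState C M}
    {r : NodeState C M × Option (Packet C M)} (hr : r ∈ (act P σ).support) :
    r.1.known = σ.known := by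
  rw [act, PMF.mem_support_bind_iff] at hr
  obtain ⟨ρ, hρ, hr⟩ := hr
  have known_eq : ρ.known = σ.known := by
    unfold prepare at hρ
    split at hρ
    · obtain ⟨l, -, rfl⟩ := (PMF.mem_support_map_iff _ _ _).1 hρ
      rfl
    · rw [(PMF.mem_support_pure_iff _ _).1 hρ]
  rw [← known_eq]
  split at hr
  · rw [(PMF.mem_support_pure_iff _ _).1 hr]
  · obtain ⟨b, -, rfl⟩ := (PMF.mem_support_map_iff _ _ _).1 hr
    rfl

lemma During.act_eq {P : Fin C → Protocol} (h : During s m t l j A σ) (hj : j < l.length)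
    (v : V) : act P (σ v) =
      (coin ((P l[j].1).prob l.length l[j].2) ((P l[j].1).prob_le_one _ _)).map fun b =>
        (σ v, if b then (σ v).packet else none) := by
  have not_prepare : (σ v).source = none ∨ (σ v).packet ≠ none := by
    by_cases hv : v = s
    · exact .inr (by simp [h.packet, hv, h.mem_source, hj])
    · exact .inl (by simp [h.source, hv])
  rw [act, prepare_eq_pure not_prepare, PMF.pure_bind]
  by_cases hv : v ∈ A
  · have hp : (σ v).packet = some ⟨m, l, j⟩ := by simp [h.packet, hv, hj]
    simp [hp, transmitProb, hj]
  · have hp : (σ v).packet = none := by simp [h.packet, hv]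
    simp only [hp, ite_self]
    exact (PMF.map_const _ _).symm

lemma AtStart.act_source_eq {P : Fin C → Protocol} (h : AtStart s m t σ) :
    act P (σ s) = (samples (entry P (2 ^ (t + 1))) (2 ^ (t + 1))).bind fun l =>
      act P (load s m t σ l s) := by
  have prepare_source : prepare P (σ s) =
      (samples (entry P (2 ^ (t + 1))) (2 ^ (t + 1))).map fun l => load s m t σ l s := by
    unfold prepare
    simp [h.source, h.packet, load]
  have prepare_load (l) : prepare P (load s m t σ l s) = PMF.pure (load s m t σ l s) :=
    prepare_eq_pure (.inr (by simp [load]))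
  rw [act, prepare_source, PMF.bind_map]
  congr 1
  funext l
  rw [act, prepare_load, PMF.pure_bind]
  rfl

end

end Framework

/-! ### Iterations of the framework -/

namespace Framework

variable {C : ℕ} [NeZero C] {M V : Type} (P : Fin C → Protocol) (G : Digraph V) (s : V) (m : M)

/-- The initial configuration of the framework. -/
def initial : V → NodeState C M := (framework P M).init s m

lemma atStart_initial : AtStart s m 0 (initial P s m) where
  source v := by by_cases hv : v = s <;> simp [initial, BlindAlgorithm.init, framework, hv]
  known v := by by_cases hv : v = s <;> simp [initial, BlindAlgorithm.init, framework, hv]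
  known_source := by simp [initial, BlindAlgorithm.init, framework]
  packet v := by by_cases hv : v = s <;> simp [initial, BlindAlgorithm.init, framework, hv]

variable [Fintype V]

/-- The transition law of the framework on configurations. -/
def step (σ : V → NodeState C M) : PMF (V → NodeState C M) :=
  (independent fun v => act P (σ v)).map fun r v => hear (r v).1 (heard G (fun u => (r u).2) v)

lemma failureProb_eq (τ : ℕ) : (framework P M).failureProb G s m τ =
    (chain (step P G) τ (initial P s m)).toOuterMeasure {σ | ∀ v, (σ v).known = some m}ᶜ :=
  failureProb_eq_chain (framework P M) G s m τ

variable (V) in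
/-- The joint law of the coins of all nodes in a time-step of an iteration of length `T` whose
schedule entry is `e`. The coins of inactive nodes have no effect. -/
def transmitters (T : ℕ) (e : Fin C × ℕ) : PMF (V → Bool) :=
  independent fun _ => coin ((P e.1).prob T e.2) ((P e.1).prob_le_one T e.2)

variable (V) in
/-- The joint law of the coins of all nodes in a time-step of an iteration of length `T`, averaged
over the schedule entry. -/
def transmitLaw (T : ℕ) : PMF (V → Bool) := (entry P T).bind (transmitters V P T)

variable {P G s m} {t j : ℕ} {l : List (Fin C × ℕ)} {A : Set V}
  {σ : V → NodeState C M}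

lemma During.step_eq (h : During s m t l j A σ) (hj : j < l.length) :
    step P G σ = (transmitters V P l.length l[j]).map (Framework.advance G σ) := by
  have act_eq : (fun v => act P (σ v)) = fun v =>
      (coin ((P l[j].1).prob l.length l[j].2) ((P l[j].1).prob_le_one _ _)).map fun b =>
        (σ v, if b then (σ v).packet else none) :=
    funext (h.act_eq hj)
  rw [step, act_eq, independent_map, PMF.map_comp]
  rfl

lemma AtStart.step_eq (h : AtStart s m t σ) :
    step P G σ = (samples (entry P (2 ^ (t + 1))) (2 ^ (t + 1))).bind fun l =>
      step P G (load s m t σ l) := by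
  classical
  have act_load (l) : (fun v => act P (load s m t σ l v)) =
      Function.update (fun v => act P (σ v)) s (act P (load s m t σ l s)) := by
    funext v
    by_cases hv : v = s
    · subst hv
      simp
    · simp [load, hv]
  simp only [step, act_load]
  rw [← PMF.map_bind, ← independent_update_bind, ← h.act_source_eq, Function.update_eq_self]

lemma During.expect_chain_le {F : (V → NodeState C M) → ℝ≥0∞} {F' : Set V → ℝ≥0∞}
    (hF : ∀ A' σ', During s m t l l.length A' σ' → F σ' ≤ F' A') :
    ∀ {k j : ℕ} {A : Set V} {σ : V → NodeState C M}, During s m t l j A σ → j + k = l.length →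
      expect (chain (step P G) k σ) F ≤
        expect (activeLaw G (transmitters V P l.length) (l.drop j) A) F'
  | 0, j, A, σ, h, hk => by
    obtain rfl : j = l.length := hk
    rw [chain, List.drop_length, activeLaw, expect_pure, expect_pure]
    exact hF A σ h
  | k + 1, j, A, σ, h, hk => by
    have hj : j < l.length := by lia
    rw [chain, h.step_eq hj, List.drop_eq_getElem_cons hj, activeLaw, spreadLaw, expect_bind,
      expect_map, expect_bind, expect_map]
    exact expect_mono fun b => (h.advance hj b).expect_chain_le hF (by lia)

lemma AtStart.expect_chain_le {F : (V → NodeState C M) → ℝ≥0∞} {F' : Set V → ℝ≥0∞}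
    (hF : ∀ l A' σ', During s m (t + 1) l l.length A' σ' → F σ' ≤ F' A')
    (h : AtStart s m t σ) :
    expect (chain (step P G) (2 ^ (t + 1)) σ) F ≤
      expect (chain (spreadLaw G (transmitLaw V P (2 ^ (t + 1)))) (2 ^ (t + 1)) {s}) F' := by
  obtain ⟨k, hk⟩ : ∃ k, 2 ^ (t + 1) = k + 1 :=
    Nat.exists_eq_succ_of_ne_zero (by positivity)
  have chain_eq : chain (step P G) (2 ^ (t + 1)) σ =
      (samples (entry P (2 ^ (t + 1))) (2 ^ (t + 1))).bind fun l =>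
        chain (step P G) (2 ^ (t + 1)) (load s m t σ l) := by
    simp only [hk, chain]
    rw [h.step_eq, hk, PMF.bind_bind]
  rw [chain_eq, transmitLaw, ← samples_bind_activeLaw, expect_bind, expect_bind]
  refine expect_mono_of_mem_support fun l hl => ?_
  have length_eq : l.length = 2 ^ (t + 1) := length_of_mem_support_samples _ hl
  have during : During s m (t + 1) l 0 {s} (load s m t σ l) :=
    h.during_load (length_eq ▸ by positivity)
  simpa [length_eq] using during.expect_chain_le (P := P) (G := G) (k := 2 ^ (t + 1))
    (hF l) (by lia)

lemma support_chain_subset_atStart (h : AtStart s m t σ) :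
    (chain (step P G) (2 ^ (t + 1)) σ).support ⊆ {σ' | AtStart s m (t + 1) σ'} := by
  have expect_eq_zero : expect (chain (step P G) (2 ^ (t + 1)) σ)
      ({σ' | AtStart s m (t + 1) σ'}ᶜ.indicator 1) ≤ 0 := by
    refine (h.expect_chain_le (F' := fun _ => 0) fun l A' σ' h' => ?_).trans_eq
      (expect_const _ 0)
    rw [Set.indicator_of_notMem (by simpa using h'.atStart)]
  rwa [expect_indicator, nonpos_iff_eq_zero, PMF.toOuterMeasure_apply_eq_zero_iff,
    Set.disjoint_compl_right_iff_subset] at expect_eq_zero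

variable (P G s m)

lemma support_chain_initial_subset : ∀ t,
    (chain (step P G) (2 ^ (t + 1) - 2) (initial P s m)).support ⊆
      {σ | AtStart s m t σ}
  | 0 => by
    simpa [chain] using atStart_initial P s m
  | t + 1 => by
    have iteration_start : 2 ^ (t + 1 + 1) - 2 = (2 ^ (t + 1) - 2) + 2 ^ (t + 1) := by lia
    rw [iteration_start, chain_add, PMF.support_bind]
    exact Set.iUnion₂_subset fun σ hσ =>
      support_chain_subset_atStart (support_chain_initial_subset t hσ)

lemma antitone_failureProb : Antitone ((framework P M).failureProb G s m) := by
  have forall_known (σ : V → NodeState C M) (hσ : σ ∈ {σ | ∀ v, (σ v).known = some m}) :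
      (step P G σ).support ⊆ {σ | ∀ v, (σ v).known = some m} := by
    rw [step, PMF.support_map, Set.image_subset_iff]
    intro r hr v
    change ((r v).1.known.or _) = some m
    rw [known_eq_of_mem_support_act (mem_support_of_mem_support_independent hr v), hσ v]
    rfl
  intro τ τ' h
  rw [failureProb_eq, failureProb_eq]
  exact antitone_toOuterMeasure_chain_compl forall_known _ h

lemma failureProb_le_sum (t : ℕ) :
    (framework P M).failureProb G s m (2 ^ (t + 2) - 2) ≤
      ∑ v, (chain (spreadLaw G (transmitLaw V P (2 ^ (t + 1)))) (2 ^ (t + 1)) {s}).toOuterMeasure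
        {A | v ∉ A} := by
  have iteration_end : 2 ^ (t + 2) - 2 = (2 ^ (t + 1) - 2) + 2 ^ (t + 1) := by lia
  have unknown_eq : {σ : V → NodeState C M | ∀ v, (σ v).known = some m}ᶜ =
      ⋃ v, {σ | (σ v).known ≠ some m} := by
    ext σ
    simp
  rw [failureProb_eq, iteration_end, chain_add, toOuterMeasure_bind]
  refine expect_le_of_forall_mem_support fun σ hσ => ?_
  have atStart : AtStart s m t σ := support_chain_initial_subset P G s m t hσ
  rw [unknown_eq]
  refine (MeasureTheory.measure_iUnion_fintype_le _ _).trans (Finset.sum_le_sum fun v _ => ?_)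
  rw [← expect_indicator, ← expect_indicator]
  refine atStart.expect_chain_le fun l A σ' h' => ?_
  by_cases hv : v ∈ A
  · rw [Set.indicator_of_notMem (by simpa using h'.known_of_mem v hv)]
    exact zero_le
  · rw [Set.indicator_of_mem (s := {A | v ∉ A}) hv]
    exact Set.indicator_le_self' (fun _ _ => zero_le) σ'

end Framework

/-! ### The front on a walk -/

/-- `w 0, w 1, …, w d` is a directed walk in `G`; the values of `w` beyond `d` are irrelevant. -/
def IsWalk {V : Type} (G : Digraph V) (w : ℕ → V) (d : ℕ) : Prop :=
  ∀ i < d, G.Adj (w i) (w (i + 1))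

lemma Steps.exists_isWalk {V : Type} {G : Digraph V} {u : V} :
    ∀ {k : ℕ} {v : V}, Steps G k u v → ∃ w : ℕ → V, IsWalk G w k ∧ w 0 = u ∧ w k = v
  | 0, v, h => ⟨fun _ => u, fun _ hi => absurd hi (Nat.not_lt_zero _), rfl, h⟩
  | k + 1, v, ⟨x, hx, hxv⟩ => by
    obtain ⟨w, hw, h0, hk⟩ := hx.exists_isWalk
    refine ⟨fun i => if i ≤ k then w i else v, fun i hi => ?_, by simp [h0], by simp⟩
    rcases Nat.lt_succ_iff_lt_or_eq.1 hi with h | rfl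
    · simpa [h.le, Nat.succ_le_of_lt h] using hw i h
    · simpa [hk] using hxv

section walk

variable {V : Type}

open Classical in
/-- The last position `i ≤ d` on `w` such that `u` can transmit to `w i`; it is `0` if there is no
such position. -/
def reach (G : Digraph V) (w : ℕ → V) (d : ℕ) (u : V) : ℕ :=
  Nat.findGreatest (fun i => G.Adj u (w i)) d

open Classical in
/-- The number of nodes whose last out-neighbour on `w` is at position `i`. It bounds the number of
active in-neighbours of `w i` while `i` is the front. -/
def width [Fintype V] (G : Digraph V) (w : ℕ → V) (d i : ℕ) : ℕ :=
  (Finset.univ.filter fun u => reach G w d u = i).card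

lemma width_le_card [Fintype V] (G : Digraph V) (w : ℕ → V) (d i : ℕ) :
    width G w d i ≤ Fintype.card V :=
  Finset.card_le_univ _

lemma sum_width_le_card [Fintype V] (G : Digraph V) (w : ℕ → V) (d : ℕ) (I : Finset ℕ) :
    ∑ i ∈ I, width G w d i ≤ Fintype.card V := by
  classical
  unfold width
  rw [← Finset.card_biUnion fun i _ j _ hij => Finset.disjoint_filter.2
    fun u _ hi hj => hij (hi.symm.trans hj)]
  exact Finset.card_le_univ _

open Classical in
/-- The last position `i ≤ d` on `w` such that some node of `A` can transmit to `w i`; it is `0` if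
there is no such position. -/
def front (G : Digraph V) (w : ℕ → V) (d : ℕ) (A : Set V) : ℕ :=
  Nat.findGreatest (fun i => ∃ u ∈ A, G.Adj u (w i)) d

section front

variable {G : Digraph V} {w : ℕ → V} {d : ℕ} {A B : Set V}

lemma front_le : front G w d A ≤ d := by
  classical exact Nat.findGreatest_le d

lemma le_front {i : ℕ} (hi : i ≤ d) {u : V} (hu : u ∈ A) (h : G.Adj u (w i)) :
    i ≤ front G w d A := by
  classical exact Nat.le_findGreatest hi ⟨u, hu, h⟩

lemma front_mono (h : A ⊆ B) : front G w d A ≤ front G w d B := by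
  classical exact Nat.findGreatest_mono_left (fun _ ⟨u, hu, hi⟩ => ⟨u, h hu, hi⟩) d

lemma lt_front_of_mem (hw : IsWalk G w d) {i : ℕ} (hi : i ≤ d) (hA : w i ∈ A) (hd : w d ∉ A) :
    i < front G w d A := by
  have hid : i < d := lt_of_le_of_ne hi fun h => hd (h ▸ hA)
  exact le_front hid hA (hw i hid)

lemma front_mem_Icc (hw : IsWalk G w d) (h0 : w 0 ∈ A) (hd : w d ∉ A) :
    front G w d A ∈ Finset.Icc 1 d :=
  Finset.mem_Icc.2 ⟨lt_front_of_mem hw (Nat.zero_le d) h0 hd, front_le⟩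

lemma exists_adj_front (hw : IsWalk G w d) (h0 : w 0 ∈ A) (hd : w d ∉ A) :
    ∃ u ∈ A, G.Adj u (w (front G w d A)) := by
  classical
  exact Nat.findGreatest_of_ne_zero (P := fun i => ∃ u ∈ A, G.Adj u (w i)) rfl
    (lt_front_of_mem hw (Nat.zero_le d) h0 hd).ne'

lemma reach_eq_front {u : V} (hu : u ∈ A) (h : G.Adj u (w (front G w d A))) :
    reach G w d u = front G w d A := by
  classical
  refine le_antisymm ?_ (Nat.le_findGreatest front_le h)
  rcases Nat.eq_zero_or_pos (reach G w d u) with h0 | h0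
  · lia
  · exact le_front (Nat.findGreatest_le d) hu
      (Nat.findGreatest_of_ne_zero (P := fun i => G.Adj u (w i)) rfl h0.ne')

end front

/-! ### The potential -/

open Classical in
/-- The potential of the active set `A` with respect to the walk `w` and the weights `g`: the
product of the weights of the positions that the front has not yet passed. It is `0` once the end
of the walk is active. -/
def potential (G : Digraph V) (w : ℕ → V) (d : ℕ) (g : ℕ → ℝ≥0) (A : Set V) : ℝ≥0 :=
  if w d ∈ A then 0 else ∏ j ∈ Finset.Ico (front G w d A) (d + 1), g j

section potential

variable {G : Digraph V} {w : ℕ → V} {d : ℕ} {g : ℕ → ℝ≥0} {A B : Set V}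

lemma one_le_potential (hg : ∀ j, 1 ≤ g j) (hd : w d ∉ A) : 1 ≤ potential G w d g A := by
  rw [potential, if_neg hd]
  exact Finset.one_le_prod' fun j _ => hg j

lemma potential_le_prod (hg : ∀ j, 1 ≤ g j) (hw : IsWalk G w d) (h0 : w 0 ∈ A) :
    potential G w d g A ≤ ∏ j ∈ Finset.Icc 1 d, g j := by
  unfold potential
  split_ifs with hd
  · exact zero_le
  · exact Finset.prod_le_prod_of_subset_of_one_le'
      (Finset.Ico_subset_Ico_left (Finset.mem_Icc.1 (front_mem_Icc hw h0 hd)).1) fun j _ _ => hg j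

lemma potential_anti (hg : ∀ j, 1 ≤ g j) (hAB : A ⊆ B) :
    potential G w d g B ≤ potential G w d g A := by
  unfold potential
  split_ifs with hB hA hA
  · rfl
  · exact zero_le
  · exact absurd (hAB hA) hB
  · exact Finset.prod_le_prod_of_subset_of_one_le' (Finset.Ico_subset_Ico_left (front_mono hAB))
      fun j _ _ => hg j

lemma weight_mul_potential_le (hg : ∀ j, 1 ≤ g j) (hw : IsWalk G w d) (hA : w d ∉ A)
    (hB : w (front G w d A) ∈ B) :
    g (front G w d A) * potential G w d g B ≤ potential G w d g A := by
  unfold potential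
  split_ifs with hd
  · simp
  · have front_lt : front G w d A < front G w d B := lt_front_of_mem hw front_le hB hd
    rw [Finset.prod_eq_prod_Ico_succ_bot (a := front G w d A) (Nat.lt_succ_of_le front_le)]
    exact mul_le_mul_right (Finset.prod_le_prod_of_subset_of_one_le'
      (Finset.Ico_subset_Ico_left front_lt) fun j _ _ => hg j) _

end potential

/-! ### Progress along a walk -/

/-- The probability that the coin of exactly one node of `N` shows `true`, if the coins have the
joint law `μ`. -/
def hitProb (μ : PMF (V → Bool)) (N : Finset V) : ℝ≥0∞ :=
  μ.toOuterMeasure {b | ∃! u, u ∈ N ∧ b u = true}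

section progress

variable {μ : PMF (V → Bool)} {G : Digraph V} {w : ℕ → V} {d : ℕ} {A : Set V}

lemma one_le_inv_one_sub {x : ℝ≥0} (hx : x < 1) : 1 ≤ (1 - x)⁻¹ :=
  (one_le_inv₀ (tsub_pos_of_lt hx)).2 tsub_le_self

lemma potential_spread_add_le {x : ℕ → ℝ≥0} (hx : ∀ i, x i < 1) (hw : IsWalk G w d)
    (hd : w d ∉ A) {b : V → Bool} (hb : w (front G w d A) ∈ spread G A b) :
    potential G w d (fun i => (1 - x i)⁻¹) (spread G A b) +
        x (front G w d A) * potential G w d (fun i => (1 - x i)⁻¹) A ≤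
      potential G w d (fun i => (1 - x i)⁻¹) A := by
  set i := front G w d A
  have pos : 0 < 1 - x i := tsub_pos_of_lt (hx i)
  have drop_le := weight_mul_potential_le (fun j => one_le_inv_one_sub (hx j)) hw hd hb
  rw [inv_mul_le_iff₀ pos] at drop_le
  calc _ ≤ (1 - x i) * potential G w d (fun i => (1 - x i)⁻¹) A +
        x i * potential G w d (fun i => (1 - x i)⁻¹) A := by gcongr
    _ = _ := by rw [← add_mul, tsub_add_cancel_of_le (hx i).le, one_mul]

variable [Fintype V]

lemma exists_finset_mem_spread (hw : IsWalk G w d) (h0 : w 0 ∈ A) (hd : w d ∉ A) :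
    ∃ N : Finset V, N.Nonempty ∧ N.card ≤ width G w d (front G w d A) ∧
      ∀ b : V → Bool, (∃! u, u ∈ N ∧ b u = true) → w (front G w d A) ∈ spread G A b := by
  classical
  refine ⟨Finset.univ.filter fun u => G.Adj u (w (front G w d A)) ∧ u ∈ A, ?_, ?_, fun b hb => ?_⟩
  · obtain ⟨u, hu, hadj⟩ := exists_adj_front hw h0 hd
    exact ⟨u, by simpa using ⟨hadj, hu⟩⟩
  · refine Finset.card_le_card fun u hu => ?_
    simp only [Finset.mem_filter, Finset.mem_univ, true_and] at hu ⊢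
    exact reach_eq_front hu.2 hu.1
  · exact .inr (by simpa [and_assoc] using hb)

lemma expect_potential_spread_le {x : ℕ → ℝ≥0} (hx : ∀ i, x i < 1) (hw : IsWalk G w d)
    {r : ℝ≥0∞} (hr : ∀ i ∈ Finset.Icc 1 d, ∀ N : Finset V, N.Nonempty → N.card ≤ width G w d i →
      r ≤ x i * hitProb μ N) (h0 : w 0 ∈ A) :
    expect (spreadLaw G μ A) (fun B => potential G w d (fun i => (1 - x i)⁻¹) B) ≤
      (1 - r) * potential G w d (fun i => (1 - x i)⁻¹) A := by
  set Φ := potential G w d fun i => (1 - x i)⁻¹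
  rw [spreadLaw, expect_map]
  by_cases hd : w d ∈ A
  · have potential_eq_zero (b) : Φ (spread G A b) = 0 := if_pos (subset_spread A b hd)
    simp [potential_eq_zero, expect_const]
  obtain ⟨N, nonempty, card_le, mem_spread⟩ := exists_finset_mem_spread hw h0 hd
  set i := front G w d A
  have drop_le (b) : (Φ (spread G A b) : ℝ≥0∞) +
      x i * Φ A * {b | ∃! u, u ∈ N ∧ b u = true}.indicator 1 b ≤ Φ A := by
    by_cases hb : b ∈ {b : V → Bool | ∃! u, u ∈ N ∧ b u = true}
    · rw [Set.indicator_of_mem hb, Pi.one_apply, mul_one]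
      exact_mod_cast potential_spread_add_le hx hw hd (mem_spread b hb)
    · rw [Set.indicator_of_notMem hb, mul_zero, add_zero]
      exact_mod_cast potential_anti (fun j => one_le_inv_one_sub (hx j)) (subset_spread A b)
  have sum_le : expect μ (fun b => (Φ (spread G A b) : ℝ≥0∞)) + r * Φ A ≤ Φ A := by
    calc _ ≤ expect μ (fun b => (Φ (spread G A b) : ℝ≥0∞)) + x i * hitProb μ N * Φ A := by
          gcongr
          exact hr i (front_mem_Icc hw h0 hd) N nonempty card_le
      _ = expect μ fun b => (Φ (spread G A b) : ℝ≥0∞) +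
            x i * Φ A * {b | ∃! u, u ∈ N ∧ b u = true}.indicator 1 b := by
          rw [expect_add, expect_const_mul, expect_indicator, mul_right_comm, hitProb]
      _ ≤ Φ A := (expect_mono drop_le).trans_eq (expect_const _ _)
  rw [ENNReal.sub_mul fun _ _ => ENNReal.coe_ne_top, one_mul]
  exact ENNReal.le_sub_of_add_le_right
    (ne_top_of_le_ne_top ENNReal.coe_ne_top (le_add_self.trans sum_le)) sum_le

lemma toOuterMeasure_chain_spreadLaw_le {x : ℕ → ℝ≥0} (hx : ∀ i, x i < 1) (hw : IsWalk G w d)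
    {r : ℝ≥0∞} (hr : ∀ i ∈ Finset.Icc 1 d, ∀ N : Finset V, N.Nonempty → N.card ≤ width G w d i →
      r ≤ x i * hitProb μ N) (k : ℕ) :
    (chain (spreadLaw G μ) k {w 0}).toOuterMeasure {A | w d ∉ A} ≤
      (1 - r) ^ k * ∏ i ∈ Finset.Icc 1 d, (1 - x i)⁻¹ := by
  have one_le_weight (i) : 1 ≤ (1 - x i)⁻¹ := one_le_inv_one_sub (hx i)
  calc _ = expect (chain (spreadLaw G μ) k {w 0}) ({A | w d ∉ A}.indicator 1) :=
        (expect_indicator _ _).symm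
    _ ≤ expect (chain (spreadLaw G μ) k {w 0})
          (fun A => potential G w d (fun i => (1 - x i)⁻¹) A) := by
        refine expect_mono (Set.indicator_le fun A hA => ?_)
        exact ENNReal.one_le_coe_iff.2 (one_le_potential one_le_weight hA)
    _ ≤ (1 - r) ^ k * potential G w d (fun i => (1 - x i)⁻¹) {w 0} :=
        expect_chain_le (S := {A | w 0 ∈ A}) (fun A hA => support_spreadLaw_subset μ (w 0) hA)
          (fun A hA => expect_potential_spread_le hx hw hr hA) k rfl
    _ ≤ (1 - r) ^ k * ∏ i ∈ Finset.Icc 1 d, (1 - x i)⁻¹ := by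
        gcongr
        exact potential_le_prod one_le_weight hw rfl

lemma one_sub_ofReal_le_ofReal_exp (r : ℝ) :
    1 - ENNReal.ofReal r ≤ ENNReal.ofReal (Real.exp (-r)) := by
  rw [tsub_le_iff_right, ← ENNReal.ofReal_one]
  refine (ENNReal.ofReal_le_ofReal ?_).trans ENNReal.ofReal_add_le
  linarith [Real.add_one_le_exp (-r)]

lemma inv_one_sub_le_exp {x : ℝ} (h0 : 0 ≤ x) (hx : x ≤ 1 / 2) : (1 - x)⁻¹ ≤ Real.exp (2 * x) := by
  refine le_trans ?_ (Real.add_one_le_exp _)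
  rw [inv_le_iff_one_le_mul₀ (by linarith)]
  nlinarith

lemma toOuterMeasure_chain_spreadLaw_le_exp {x : ℕ → ℝ} (h0 : ∀ i, 0 ≤ x i)
    (hx : ∀ i, x i ≤ 1 / 2) (hw : IsWalk G w d) {r : ℝ}
    (hr : ∀ i ∈ Finset.Icc 1 d, ∀ N : Finset V, N.Nonempty → N.card ≤ width G w d i →
      ENNReal.ofReal r ≤ ENNReal.ofReal (x i) * hitProb μ N) (k : ℕ) :
    (chain (spreadLaw G μ) k {w 0}).toOuterMeasure {A | w d ∉ A} ≤
      ENNReal.ofReal (Real.exp (2 * ∑ i ∈ Finset.Icc 1 d, x i - r * k)) := by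
  have toNNReal_lt_one (i) : (x i).toNNReal < 1 :=
    Real.toNNReal_lt_one.2 ((hx i).trans_lt (by norm_num))
  have weight_le (i) : (((1 - (x i).toNNReal)⁻¹ : ℝ≥0) : ℝ≥0∞) ≤
      ENNReal.ofReal (Real.exp (2 * x i)) := by
    rw [← ENNReal.ofReal_coe_nnreal, NNReal.coe_inv, NNReal.coe_sub (toNNReal_lt_one i).le,
      NNReal.coe_one, Real.coe_toNNReal _ (h0 i)]
    exact ENNReal.ofReal_le_ofReal (inv_one_sub_le_exp (h0 i) (hx i))
  calc _ ≤ (1 - ENNReal.ofReal r) ^ k * ∏ i ∈ Finset.Icc 1 d, (1 - (x i).toNNReal)⁻¹ :=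
        toOuterMeasure_chain_spreadLaw_le toNNReal_lt_one hw hr k
    _ ≤ ENNReal.ofReal (Real.exp (-r)) ^ k *
          ∏ i ∈ Finset.Icc 1 d, ENNReal.ofReal (Real.exp (2 * x i)) := by
        rw [ENNReal.ofNNReal_finsetProd]
        gcongr
        · exact one_sub_ofReal_le_ofReal_exp r
        · exact weight_le _
    _ = ENNReal.ofReal (Real.exp (2 * ∑ i ∈ Finset.Icc 1 d, x i - r * k)) := by
        rw [← ENNReal.ofReal_pow (Real.exp_nonneg _),
          ← ENNReal.ofReal_prod_of_nonneg fun i _ => Real.exp_nonneg _,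
          ← ENNReal.ofReal_mul (by positivity), ← Real.exp_sum, ← Real.exp_nat_mul,
          ← Real.exp_add, ← Finset.mul_sum]
        ring_nf

end progress

end walk

/-! ### Logarithms -/

lemma one_le_log (x : ℝ) : 1 ≤ log x := le_max_right _ _

lemma logb_le_log (x : ℝ) : Real.logb 2 x ≤ log x := le_max_left _ _

lemma log_two : log 2 = 1 := by simp [log]

lemma log_le_log {x y : ℝ} (hx : 0 ≤ x) (h : x ≤ y) : log x ≤ log y := by
  rcases hx.eq_or_lt with rfl | hx
  · simp [log]
  · exact max_le_max_right 1 (Real.logb_le_logb_of_le one_lt_two hx h)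

lemma real_log_le_log {x : ℝ} (hx : 1 ≤ x) : Real.log x ≤ log x := by
  refine le_trans ?_ (logb_le_log x)
  refine le_div_self (Real.log_nonneg hx) (Real.log_pos one_lt_two) ?_
  linarith [Real.log_two_lt_d9]

lemma log_mul_le_add {x y : ℝ} (hx : 0 < x) (hy : 0 < y) : log (x * y) ≤ log x + log y := by
  refine max_le ?_ (by linarith [one_le_log x, one_le_log y])
  rw [Real.logb_mul hx.ne' hy.ne']
  exact add_le_add (logb_le_log x) (logb_le_log y)

lemma log_mul_le_two_mul {x y : ℝ} (hx : 0 < x) (hy : 0 < y) :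
    log (x * y) ≤ 2 * (log x * log y) := by
  nlinarith [log_mul_le_add hx hy, one_le_log x, one_le_log y]

lemma log_le_two_mul_log_sqrt {x : ℝ} (hx : 0 < x) : log x ≤ 2 * log √x := by
  have := log_mul_le_add (Real.sqrt_pos.2 hx) (Real.sqrt_pos.2 hx)
  rwa [Real.mul_self_sqrt hx.le, ← two_mul] at this

lemma log_pow_le {x : ℝ} (hx : 1 ≤ x) {k : ℕ} (hk : k ≠ 0) : log x ^ k ≤ (2 * k) ^ k * x := by
  have hk1 : (1 : ℝ) ≤ k := by exact_mod_cast Nat.one_le_iff_ne_zero.2 hk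
  have log_le : log x ≤ 2 * k * x ^ (k : ℝ)⁻¹ := by
    have hroot : 1 ≤ x ^ (k : ℝ)⁻¹ := Real.one_le_rpow hx (by positivity)
    refine max_le ?_ (by nlinarith)
    have := Real.log_le_rpow_div (zero_le_one.trans hx) (ε := (k : ℝ)⁻¹) (by positivity)
    rw [Real.logb, div_le_iff₀ (Real.log_pos one_lt_two)]
    calc Real.log x ≤ 2 * k * x ^ (k : ℝ)⁻¹ * (1 / 2) := by rw [div_inv_eq_mul] at this; linarith
      _ ≤ 2 * k * x ^ (k : ℝ)⁻¹ * Real.log 2 := by gcongr; linarith [Real.log_two_gt_d9]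
  calc log x ^ k ≤ (2 * k * x ^ (k : ℝ)⁻¹) ^ k :=
        pow_le_pow_left₀ (zero_le_one.trans (one_le_log x)) log_le k
    _ = (2 * k) ^ k * x := by rw [mul_pow, Real.rpow_inv_natCast_pow (zero_le_one.trans hx) hk]

/-- The order of the expected time in which General-Broadcast makes progress against `x` competing
transmitters; in these terms, `timeBound n D` is `D * cost (n / D) + log n ^ 2`. -/
def cost (x : ℝ) : ℝ := log x * log (log x) ^ 2

lemma timeBound_eq (n D : ℕ) : timeBound n D = D * cost (n / D) + log n ^ 2 := by
  rw [timeBound, cost, mul_assoc]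

lemma one_le_cost (x : ℝ) : 1 ≤ cost x :=
  one_le_mul_of_one_le_of_one_le (one_le_log x) (one_le_pow₀ (one_le_log _))

lemma cost_le_cost {x y : ℝ} (hx : 0 ≤ x) (h : x ≤ y) : cost x ≤ cost y := by
  have hx1 := one_le_log x
  have hlog := log_le_log hx h
  have hloglog := log_le_log (zero_le_one.trans hx1) hlog
  have hy1 := one_le_log y
  have := one_le_log (log x)
  unfold cost
  gcongr

lemma cost_le_sq (x : ℝ) : cost x ≤ 16 * log x ^ 2 := by
  have := log_pow_le (one_le_log x) two_ne_zero
  norm_num at this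
  unfold cost
  nlinarith [one_le_log x]

lemma cost_le_self {x : ℝ} (hx : 1 ≤ x) : cost x ≤ 256 * x := by
  have := log_pow_le hx two_ne_zero
  norm_num at this
  linarith [cost_le_sq x]

lemma log_mul_sq_le {a b : ℝ} (ha : 0 < a) (hb : 0 < b) :
    log (a * b) ^ 2 ≤ 4 * (log a ^ 2 * log b ^ 2) := by
  have := one_le_log (a * b)
  calc log (a * b) ^ 2 ≤ (2 * (log a * log b)) ^ 2 := by gcongr; exact log_mul_le_two_mul ha hb
    _ = _ := by ring

lemma cost_mul_le {x y : ℝ} (hx : 0 < x) (hy : 0 < y) :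
    cost (x * y) ≤ 32 * (cost x * cost y) := by
  have hx1 : 0 < log x := zero_lt_one.trans_le (one_le_log x)
  have hy1 : 0 < log y := zero_lt_one.trans_le (one_le_log y)
  have hxy : 0 < log (x * y) := zero_lt_one.trans_le (one_le_log _)
  have hlog := log_mul_le_two_mul hx hy
  have hloglog : log (log (x * y)) ^ 2 ≤ 16 * (log (log x) ^ 2 * log (log y) ^ 2) := by
    have := zero_le_one.trans (one_le_log (log (x * y)))
    calc log (log (x * y)) ^ 2 ≤ log (2 * (log x * log y)) ^ 2 := by
          gcongr; exact log_le_log hxy.le hlog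
      _ ≤ 4 * (log 2 ^ 2 * log (log x * log y) ^ 2) := log_mul_sq_le two_pos (by positivity)
      _ ≤ 4 * (1 ^ 2 * (4 * (log (log x) ^ 2 * log (log y) ^ 2))) := by
          rw [log_two]; gcongr; exact log_mul_sq_le hx1 hy1
      _ = _ := by ring
  calc cost (x * y) ≤ 2 * (log x * log y) * (16 * (log (log x) ^ 2 * log (log y) ^ 2)) := by
        unfold cost; gcongr
    _ = _ := by unfold cost; ring

lemma cost_le_cost_sqrt {x : ℝ} (hx : 0 < x) : cost x ≤ 8 * cost √x := by
  have hlog := log_le_two_mul_log_sqrt hx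
  have hx1 := zero_le_one.trans (one_le_log x)
  have hs1 := zero_lt_one.trans_le (one_le_log √x)
  have hll := zero_le_one.trans (one_le_log (log x))
  calc cost x ≤ 2 * log √x * log (2 * log √x) ^ 2 := by
        unfold cost; gcongr; exact log_le_log hx1 hlog
    _ ≤ 2 * log √x * (4 * (log 2 ^ 2 * log (log √x) ^ 2)) := by
        gcongr; exact log_mul_sq_le two_pos hs1
    _ = 8 * cost √x := by rw [log_two, cost]; ring

lemma cost_le_cost_mul {a x : ℝ} (ha : 0 < a) (hx : 0 ≤ x) :
    cost x ≤ 8192 * (cost a * (1 + x / a)) := by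
  have hxa : 0 ≤ x / a := by positivity
  have := one_le_cost a
  calc cost x ≤ cost (a * (1 + x / a)) := by
        refine cost_le_cost hx ?_
        rw [mul_add, mul_one, mul_div_cancel₀ x ha.ne']
        linarith
    _ ≤ 32 * (cost a * cost (1 + x / a)) := cost_mul_le ha (by positivity)
    _ ≤ 32 * (cost a * (256 * (1 + x / a))) := by gcongr; exact cost_le_self (by linarith)
    _ = _ := by ring

lemma sum_cost_le {ι : Type*} {I : Finset ι} {f : ι → ℝ} {n D : ℝ} (hn : 0 < n) (hD : 0 < D)
    (hI : I.card ≤ D) (hf : ∀ i ∈ I, 0 ≤ f i) (hsum : ∑ i ∈ I, f i ≤ n) :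
    ∑ i ∈ I, cost (f i) ≤ 16384 * (D * cost (n / D)) := by
  have hcost := one_le_cost (n / D)
  calc ∑ i ∈ I, cost (f i) ≤ ∑ i ∈ I, 8192 * (cost (n / D) * (1 + f i / (n / D))) :=
        Finset.sum_le_sum fun i hi => cost_le_cost_mul (by positivity) (hf i hi)
    _ = 8192 * (cost (n / D) * (I.card + (∑ i ∈ I, f i) / (n / D))) := by
        rw [← Finset.mul_sum, ← Finset.mul_sum, Finset.sum_add_distrib, Finset.sum_div]
        simp
    _ ≤ 8192 * (cost (n / D) * (D + n / (n / D))) := by gcongr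
    _ = _ := by rw [div_div_cancel₀ hn.ne']; ring

lemma log_mul_cost_le {n D : ℝ} (hn : 1 ≤ n) (hD : log n ≤ D) :
    log n * cost n ≤ 27648 * (D * cost (n / D)) := by
  have hn0 : 0 < n := zero_lt_one.trans_le hn
  have hL := one_le_log n
  have hD0 : 0 < D := by linarith
  have hcost := one_le_cost (n / D)
  rcases le_total D √n with h | h
  · have hsqrt : cost √n ≤ cost (n / D) := by
      refine cost_le_cost (Real.sqrt_nonneg n) ((le_div_iff₀ hD0).2 ?_)
      calc √n * D ≤ √n * √n := by gcongr
        _ = n := Real.mul_self_sqrt hn0.le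
    calc log n * cost n ≤ D * (8 * cost (n / D)) := by
          gcongr
          · exact zero_le_one.trans (one_le_cost n)
          · exact (cost_le_cost_sqrt hn0).trans (by gcongr)
      _ ≤ 27648 * (D * cost (n / D)) := by linarith [mul_pos hD0 (zero_lt_one.trans_le hcost)]
  · have hcube := log_pow_le (Real.one_le_sqrt.2 hn) three_ne_zero
    norm_num at hcube
    calc log n * cost n ≤ log n * (16 * log n ^ 2) := by gcongr; exact cost_le_sq n
      _ = 16 * log n ^ 3 := by ring
      _ ≤ 16 * (2 * log √n) ^ 3 := by gcongr; exact log_le_two_mul_log_sqrt hn0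
      _ ≤ 27648 * √n := by linarith
      _ ≤ 27648 * (D * cost (n / D)) := by
          gcongr; exact h.trans (le_mul_of_one_le_right hD0.le hcost)

/-! ### Progress probabilities of the two protocols -/

/-- The guess suited to `m` competing transmitters: `m * 2⁻¹ ^ bits m` lies between `1 / 4` and
`1 / 2`. -/
def bits (m : ℕ) : ℕ := Nat.log 2 m + 2

lemma mul_two_inv_pow_bits_le (m : ℕ) : (m : ℝ) * (1 / 2) ^ bits m ≤ 1 / 2 := by
  have h : m * 2 ≤ 2 ^ bits m := by
    have := Nat.lt_pow_succ_log_self one_lt_two m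
    rw [bits, pow_succ]
    omega
  have h' : (m : ℝ) * 2 ≤ 2 ^ bits m := by exact_mod_cast h
  rw [one_div_pow, mul_one_div, div_le_div_iff₀ (by positivity) two_pos]
  linarith

lemma le_mul_two_inv_pow_bits {m : ℕ} (hm : m ≠ 0) : 1 / 4 ≤ (m : ℝ) * (1 / 2) ^ bits m := by
  have h : 2 ^ bits m ≤ m * 4 := by
    have := Nat.pow_log_le_self 2 hm
    rw [bits, pow_add]
    omega
  have h' : (2 : ℝ) ^ bits m ≤ m * 4 := by exact_mod_cast h
  rw [one_div_pow, mul_one_div, div_le_div_iff₀ four_pos (by positivity)]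
  linarith

lemma one_eighth_le_mul_mul_one_sub_pow {m : ℕ} {p : ℝ} (h0 : 1 / 4 ≤ m * p)
    (h1 : m * p ≤ 1 / 2) : 1 / 8 ≤ m * (p * (1 - p) ^ (m - 1)) := by
  obtain _ | k := m
  · norm_num at h0
  rw [Nat.add_sub_cancel]
  push_cast at h0 h1 ⊢
  have hp : 0 < p := by
    by_contra! hp
    nlinarith [mul_nonpos_of_nonneg_of_nonpos (by positivity : (0 : ℝ) ≤ k + 1) hp]
  have hk : 0 ≤ k * p := by positivity
  have hbernoulli : 1 / 2 ≤ (1 - p) ^ k := by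
    have := one_add_mul_le_pow (a := -p) (by linarith) k
    rw [← sub_eq_add_neg] at this
    linarith
  nlinarith

lemma cast_bits_le (m : ℕ) : (bits m : ℝ) ≤ 3 * log m := by
  have := (Real.natLog_le_logb m 2).trans (logb_le_log m)
  rw [bits]
  push_cast
  linarith [one_le_log m]

lemma bits_mul_log_bits_sq_le (m : ℕ) : bits m * log (bits m) ^ 2 ≤ 48 * cost m := by
  have hm : 0 < log m := zero_lt_one.trans_le (one_le_log m)
  have hbits := one_le_log (bits m)
  have log_three_le : log 3 ≤ 2 := by
    have := (log_le_log (by norm_num) (by norm_num : (3 : ℝ) ≤ 2 * 2)).trans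
      (log_mul_le_add two_pos two_pos)
    rw [log_two] at this
    linarith
  have := one_le_log 3
  calc bits m * log (bits m) ^ 2 ≤ 3 * log m * log (3 * log m) ^ 2 := by
        gcongr
        · exact cast_bits_le m
        · exact log_le_log (Nat.cast_nonneg _) (cast_bits_le m)
    _ ≤ 3 * log m * (4 * (2 ^ 2 * log (log m) ^ 2)) := by
        gcongr
        exact (log_mul_sq_le three_pos hm).trans (by gcongr)
    _ = 48 * cost m := by rw [cost]; ring

open Framework

section hitProb

variable {V : Type} [Fintype V] {N : Finset V}

open Classical in
lemma one_eighth_le_coin_existsUnique {p : ℝ≥0} (hp : p ≤ 1) (h0 : 1 / 4 ≤ (N.card * p : ℝ))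
    (h1 : (N.card * p : ℝ) ≤ 1 / 2) :
    ENNReal.ofReal (1 / 8) ≤
      (independent fun _ => coin p hp).toOuterMeasure {b | ∃! u, u ∈ N ∧ b u = true} := by
  have hcard : ∀ u ∈ N, p * ∏ _w ∈ N.erase u, (1 - p) = p * (1 - p) ^ (N.card - 1) := by
    intro u hu
    rw [Finset.prod_const, Finset.card_erase_of_mem hu]
  rw [toOuterMeasure_coin_existsUnique, Finset.sum_congr rfl hcard, Finset.sum_const, nsmul_eq_mul,
    ENNReal.ofReal, ENNReal.coe_le_coe, Real.toNNReal_le_iff_le_coe]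
  push_cast [NNReal.coe_sub hp]
  exact one_eighth_le_mul_mul_one_sub_pow h0 h1

lemma le_hitProb_transmitLaw {C : ℕ} [NeZero C] (P : Fin C → Protocol) (T : ℕ) (i : Fin C)
    (hN : N.Nonempty) (hP : (P i).prob T (bits N.card) = (1 / 2) ^ bits N.card) :
    (C : ℝ≥0∞)⁻¹ * ((P i).guess T (bits N.card) * ENNReal.ofReal (1 / 8)) ≤
      hitProb (transmitLaw V P T) N := by
  rw [hitProb, transmitLaw, toOuterMeasure_bind, entry, expect_bind]
  refine le_trans ?_ (mul_le_expect _ _ i)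
  rw [PMF.uniformOfFintype_apply, Fintype.card_fin, expect_map]
  gcongr
  refine le_trans ?_ (mul_le_expect _ _ (bits N.card))
  gcongr
  refine one_eighth_le_coin_existsUnique _ ?_ ?_ <;> rw [hP] <;> push_cast
  · exact le_mul_two_inv_pow_bits hN.card_pos.ne'
  · exact mul_two_inv_pow_bits_le _

/-- The two protocols that `broadcast c` combines. -/
abbrev protocols (c : ℝ) : Fin 2 → Protocol := ![shallowBroadcast c, generalBroadcast]

lemma ofReal_div_le_hitProb (c : ℝ) (T : ℕ) (i : Fin 2) (hN : N.Nonempty) {q : ℝ} (hq : 0 ≤ q)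
    (hguess : ENNReal.ofReal q = ((protocols c) i).guess T (bits N.card)) :
    ENNReal.ofReal (q / 16) ≤ hitProb (transmitLaw V (protocols c) T) N := by
  refine le_trans (le_of_eq ?_) (le_hitProb_transmitLaw (protocols c) T i hN ?_)
  · rw [← hguess, ← ENNReal.ofReal_natCast, ← ENNReal.ofReal_inv_of_pos (by norm_num),
      ← ENNReal.ofReal_mul hq, ← ENNReal.ofReal_mul (by positivity)]
    congr 1
    push_cast
    ring
  · fin_cases i <;> rfl

lemma withRemainder_apply {f : ℕ → ℝ≥0∞} (hf : ∑' y, f (y + 1) ≤ 1) {y : ℕ} (hy : y ≠ 0) :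
    withRemainder f hf y = f y :=
  if_neg hy

lemma bits_ne_zero (m : ℕ) : bits m ≠ 0 := Nat.succ_ne_zero _

lemma le_hitProb_of_bits_le {c : ℝ} (hc : 0 < c) {T : ℕ} (hN : N.Nonempty)
    (hT : bits N.card ≤ √T / c) :
    ENNReal.ofReal (c / √T / 16) ≤ hitProb (transmitLaw V (protocols c) T) N := by
  refine ofReal_div_le_hitProb c T 0 hN (by positivity) ?_
  change _ = withRemainder (shallowWeight c T) (tsum_shallowWeight_le c T) _
  rw [withRemainder_apply _ (bits_ne_zero _), shallowWeight,
    if_pos ⟨Nat.one_le_iff_ne_zero.2 (bits_ne_zero _), Nat.le_floor hT⟩]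

lemma le_hitProb_of_card_le (c : ℝ) (T : ℕ) (hN : N.Nonempty) {k : ℕ} (hk : N.card ≤ k) :
    ENNReal.ofReal (1 / (2304 * cost k)) ≤ hitProb (transmitLaw V (protocols c) T) N := by
  have hbits : (0 : ℝ) < bits N.card := by exact_mod_cast Nat.pos_of_ne_zero (bits_ne_zero _)
  have hlog := one_le_log (bits N.card)
  refine le_trans (ENNReal.ofReal_le_ofReal ?_) (ofReal_div_le_hitProb c T 1 hN
    (q := 1 / (3 * bits N.card * log (bits N.card) ^ 2)) (by positivity) ?_)
  · have hcost : cost N.card ≤ cost k := cost_le_cost (Nat.cast_nonneg _) (by exact_mod_cast hk)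
    rw [div_div]
    refine one_div_le_one_div_of_le (by positivity) ?_
    linarith [bits_mul_log_bits_sq_le N.card]
  · change _ = withRemainder generalWeight tsum_generalWeight_le _
    rw [withRemainder_apply _ (bits_ne_zero _), generalWeight]

end hitProb

/-! ### One long iteration -/

section iteration

variable {V : Type} [Fintype V] {G : Digraph V} {w : ℕ → V} {d D T : ℕ} {a κ : ℝ}

lemma shallow_iteration_le (ha : 0 < a) (hw : IsWalk G w d) (hd : d ≤ a * √T / 64)
    (hbits : 3 * a * log (Fintype.card V) ≤ √T)
    (hlog : 64 * κ * log (Fintype.card V) ≤ a * √T) :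
    (chain (spreadLaw G (transmitLaw V (protocols a) T)) T {w 0}).toOuterMeasure {A | w d ∉ A} ≤
      ENNReal.ofReal (Real.exp (-(κ * log (Fintype.card V)))) := by
  have hsqrt : 0 < √(T : ℝ) := by
    have := one_le_log (Fintype.card V)
    exact lt_of_lt_of_le (by positivity) hbits
  have bits_le {N : Finset V} {i : ℕ} (hN : N.card ≤ width G w d i) : bits N.card ≤ √T / a := by
    have hle : log N.card ≤ log (Fintype.card V) :=
      log_le_log (Nat.cast_nonneg _) (by exact_mod_cast hN.trans (width_le_card G w d i))
    rw [le_div_iff₀ ha]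
    nlinarith [cast_bits_le N.card]
  refine (toOuterMeasure_chain_spreadLaw_le_exp (x := fun _ => 1 / 2) (r := 1 / 2 * (a / √T / 16))
    (fun _ => by norm_num) (fun _ => le_rfl) hw (fun i _ N hN hNi => ?_) T).trans ?_
  · rw [ENNReal.ofReal_mul (by norm_num)]
    gcongr
    exact le_hitProb_of_bits_le ha hN (bits_le hNi)
  · have hrate : 1 / 2 * (a / √T / 16) * T = a * √T / 32 := by
      nth_rewrite 2 [← Real.mul_self_sqrt (Nat.cast_nonneg T)]
      field_simp
      norm_num
    rw [hrate, Finset.sum_const, Nat.card_Icc, nsmul_eq_mul, Nat.add_sub_cancel]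
    gcongr
    linarith

lemma general_iteration_le (hw : IsWalk G w d)
    (hsum : 9216 * ∑ i ∈ Finset.Icc 1 d, cost (width G w d i) ≤ T)
    (hlog : 9216 * (κ * log (Fintype.card V) * cost (Fintype.card V)) ≤ T) :
    (chain (spreadLaw G (transmitLaw V (protocols a) T)) T {w 0}).toOuterMeasure {A | w d ∉ A} ≤
      ENNReal.ofReal (Real.exp (-(κ * log (Fintype.card V)))) := by
  set n : ℝ := (Fintype.card V : ℝ)
  have hn := one_le_cost n
  have hwidth (i) : cost (width G w d i) ≤ cost n :=
    cost_le_cost (Nat.cast_nonneg _) (Nat.cast_le.2 (width_le_card G w d i))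
  have hwidth_pos (i) : 0 < cost (width G w d i) := zero_lt_one.trans_le (one_le_cost _)
  refine (toOuterMeasure_chain_spreadLaw_le_exp
    (x := fun i => cost (width G w d i) / (2 * cost n)) (r := 1 / (4608 * cost n))
    (fun i => ?_) (fun i => ?_) hw (fun i _ N hN hNi => ?_) T).trans ?_
  · have := hwidth_pos i
    positivity
  · rw [div_le_div_iff₀ (by positivity) two_pos]
    linarith [hwidth i]
  · have hr : 1 / (4608 * cost n) =
        cost (width G w d i) / (2 * cost n) * (1 / (2304 * cost (width G w d i))) := by
      have := hwidth_pos i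
      field_simp
      norm_num
    rw [hr, ENNReal.ofReal_mul (div_nonneg (hwidth_pos i).le (by positivity))]
    gcongr
    exact le_hitProb_of_card_le a T hN hNi
  · gcongr
    rw [← Finset.sum_div, ← sub_nonneg]
    have : -(κ * log n) - (2 * ((∑ i ∈ Finset.Icc 1 d, cost (width G w d i)) / (2 * cost n)) -
        1 / (4608 * cost n) * T) =
        (2 * T - 9216 * ∑ i ∈ Finset.Icc 1 d, cost (width G w d i) -
          9216 * (κ * log n * cost n)) / (9216 * cost n) := by
      field_simp
      ring
    rw [this]
    exact div_nonneg (by linarith) (by positivity)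

lemma sum_cost_width_le (hd : d ≤ D) (hD : D ≠ 0) :
    ∑ i ∈ Finset.Icc 1 d, cost (width G w d i) ≤ 16384 * (D * cost (Fintype.card V / D)) := by
  refine sum_cost_le (Nat.cast_pos.2 (Fintype.card_pos_iff.2 ⟨w 0⟩))
    (Nat.cast_pos.2 (Nat.pos_of_ne_zero hD)) ?_ (fun i _ => Nat.cast_nonneg _) ?_
  · simpa using hd
  · exact_mod_cast sum_width_le_card G w d (Finset.Icc 1 d)

lemma iteration_le (ha : 0 < a) (hκ : 0 < κ) (hw : IsWalk G w d) (hd : d ≤ D)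
    (hbits : 3 * a * log (Fintype.card V) ≤ √T)
    (hlog : 64 * (κ + 1) * log (Fintype.card V) ≤ a * √T)
    (hcost : 9216 * (16384 + 27648 * κ) * (D * cost (Fintype.card V / D)) ≤ T) :
    (chain (spreadLaw G (transmitLaw V (protocols a) T)) T {w 0}).toOuterMeasure {A | w d ∉ A} ≤
      ENNReal.ofReal (Real.exp (-(κ * log (Fintype.card V)))) := by
  have hn : (1 : ℝ) ≤ Fintype.card V := Nat.one_le_cast.2 (Fintype.card_pos_iff.2 ⟨w 0⟩)
  have hn1 := one_le_log (Fintype.card V)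
  rcases le_or_gt (D : ℝ) (a * √T / 64) with h | h
  · exact shallow_iteration_le ha hw ((Nat.cast_le.2 hd).trans h) hbits (by linarith)
  · have hDlog : log (Fintype.card V) ≤ D := by nlinarith
    have hD : D ≠ 0 := by
      rintro rfl
      norm_num at hDlog
      linarith
    have hDcost : 0 ≤ D * cost (Fintype.card V / D) :=
      mul_nonneg (Nat.cast_nonneg D) (zero_le_one.trans (one_le_cost _))
    refine general_iteration_le hw ?_ ?_
    · nlinarith [sum_cost_width_le (G := G) (w := w) hd hD]
    · nlinarith [log_mul_cost_le hn hDlog]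

end iteration

lemma exists_iteration_le {a κ : ℝ} (ha : 0 < a) (hκ : 0 < κ) :
    ∃ K : ℝ, 0 < K ∧ ∀ (V : Type) [Fintype V] (G : Digraph V) (w : ℕ → V) (d D T : ℕ),
      IsWalk G w d → d ≤ D → K * timeBound (Fintype.card V) D ≤ T →
      (chain (spreadLaw G (transmitLaw V (protocols a) T)) T {w 0}).toOuterMeasure
          {A | w d ∉ A} ≤ ENNReal.ofReal (Real.exp (-(κ * log (Fintype.card V)))) := by
  let B : ℝ := 3 * a + 64 * (κ + 1) / a
  let B' : ℝ := 9216 * (16384 + 27648 * κ)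
  have : 0 < B := by positivity
  have hB' : 0 < B' := by positivity
  refine ⟨B ^ 2 + B', by positivity, fun V _ G w d D T hw hd hT => ?_⟩
  have hn := one_le_log (Fintype.card V)
  have hcost := one_le_cost (Fintype.card V / D)
  rw [timeBound_eq] at hT
  have hsqrt : B * log (Fintype.card V) ≤ √T := by
    refine Real.le_sqrt_of_sq_le (le_trans ?_ hT)
    rw [mul_pow]
    gcongr
    · exact le_add_of_nonneg_right hB'.le
    · exact le_add_of_nonneg_left (by positivity)
  refine iteration_le ha hκ hw hd (le_trans ?_ hsqrt) ?_ (le_trans ?_ hT)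
  · gcongr
    exact le_add_of_nonneg_right (by positivity)
  · calc 64 * (κ + 1) * log (Fintype.card V)
        = a * (64 * (κ + 1) / a * log (Fintype.card V)) := by field_simp
      _ ≤ a * (B * log (Fintype.card V)) := by gcongr; exact le_add_of_nonneg_left (by positivity)
      _ ≤ a * √T := by gcongr
  · gcongr
    · exact le_add_of_nonneg_left (by positivity)
    · exact le_add_of_nonneg_right (by positivity)

/-! ### The running time -/

lemma natCast_mul_exp_le {n : ℕ} (hn : n ≠ 0) {c : ℝ} (hc : 0 ≤ c) :
    n * Real.exp (-((c + 1) * log n)) ≤ (n : ℝ) ^ (-c) := by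
  have hn1 : (1 : ℝ) ≤ n := Nat.one_le_cast.2 (Nat.pos_of_ne_zero hn)
  have hlog := real_log_le_log hn1
  rw [Real.rpow_def_of_pos (by linarith)]
  nth_rewrite 1 [← Real.exp_log (by linarith : (0 : ℝ) < n)]
  rw [← Real.exp_add]
  gcongr
  nlinarith

lemma exists_two_pow_le {τ : ℕ} (hτ : 2 ≤ τ) :
    ∃ t, 2 ^ (t + 2) - 2 ≤ τ ∧ τ ≤ 4 * 2 ^ (t + 1) := by
  obtain ⟨t, ht⟩ : ∃ t, Nat.log 2 (τ + 2) = t + 2 :=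
    Nat.exists_eq_add_of_le' (Nat.le_log_of_pow_le one_lt_two (by lia))
  have lower : 2 ^ (t + 2) ≤ τ + 2 := ht ▸ Nat.pow_log_le_self 2 (by lia)
  have upper : τ + 2 < 2 ^ (t + 2 + 1) := ht ▸ Nat.lt_pow_succ_log_self one_lt_two _
  have : 2 ^ (t + 2 + 1) = 4 * 2 ^ (t + 1) := by ring
  exact ⟨t, by lia, by lia⟩

lemma one_le_timeBound (n D : ℕ) : 1 ≤ timeBound n D := by
  have hcost : 0 ≤ D * cost (n / D) :=
    mul_nonneg (Nat.cast_nonneg D) (zero_le_one.trans (one_le_cost _))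
  rw [timeBound_eq]
  linarith [one_le_pow₀ (n := 2) (one_le_log n)]

lemma failureProb_le_card_mul {V : Type} [Fintype V] {C : ℕ} [NeZero C] (P : Fin C → Protocol)
    {M : Type} (m : M) {G : Digraph V} {s : V} (hreach : AllReachable G s) {t : ℕ} {ε : ℝ≥0∞}
    (hε : ∀ (w : ℕ → V) (d : ℕ), IsWalk G w d → d ≤ eccentricity G s →
      (chain (spreadLaw G (transmitLaw V P (2 ^ (t + 1)))) (2 ^ (t + 1)) {w 0}).toOuterMeasure
        {A | w d ∉ A} ≤ ε) :
    (framework P M).failureProb G s m (2 ^ (t + 2) - 2) ≤ Fintype.card V * ε := by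
  refine (failureProb_le_sum P G s m t).trans ?_
  rw [← nsmul_eq_mul, ← Finset.card_univ]
  refine Finset.sum_le_card_nsmul _ _ _ fun v _ => ?_
  have hsteps : Steps G (dist G s v) s v := Nat.sInf_mem (hreach v)
  obtain ⟨w, hw, h0, hv⟩ := hsteps.exists_isWalk
  have hdist : dist G s v ≤ eccentricity G s :=
    Finset.le_sup (f := fun v => dist G s v) (Finset.mem_univ v)
  simpa only [h0, hv] using hε w _ hw hdist

end RadioNetwork

end

open RadioNetwork Framework in
theorem mainTheorem1_general {c₁ c : ℝ} (hc₁ : 0 < c₁) (hc : 0 < c) :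
    ∃ K : ℝ, 0 < K ∧ ∀ (M : Type) (m : M) (V : Type) [Fintype V] (G : Digraph V) (s : V),
      AllReachable G s → ∀ τ : ℕ, K * timeBound (Fintype.card V) (eccentricity G s) ≤ τ →
        (broadcast c₁ M).failureProb G s m τ ≤ ENNReal.ofReal ((Fintype.card V : ℝ) ^ (-c)) := by
  obtain ⟨K, hK, iteration_le⟩ := exists_iteration_le hc₁ (by linarith : 0 < c + 1)
  refine ⟨4 * K + 2, by linarith, fun M m V _ G s hreach τ hτ => ?_⟩
  have hbound := one_le_timeBound (Fintype.card V) (eccentricity G s)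
  obtain ⟨t, ht, hτt⟩ := exists_two_pow_le (τ := τ) (by exact_mod_cast (by nlinarith : (2 : ℝ) ≤ τ))
  have hT : K * timeBound (Fintype.card V) (eccentricity G s) ≤ (2 ^ (t + 1) : ℕ) := by
    have : (τ : ℝ) ≤ 4 * (2 ^ (t + 1) : ℕ) := by exact_mod_cast hτt
    linarith
  calc (broadcast c₁ M).failureProb G s m τ
      ≤ (broadcast c₁ M).failureProb G s m (2 ^ (t + 2) - 2) :=
        antitone_failureProb (protocols c₁) G s m ht
    _ ≤ Fintype.card V * ENNReal.ofReal (Real.exp (-((c + 1) * log (Fintype.card V)))) :=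
        failureProb_le_card_mul (protocols c₁) m hreach fun w d hw hd =>
          iteration_le V G w d _ _ hw hd hT
    _ ≤ ENNReal.ofReal ((Fintype.card V : ℝ) ^ (-c)) := by
        rw [← ENNReal.ofReal_natCast, ← ENNReal.ofReal_mul (Nat.cast_nonneg _)]
        exact ENNReal.ofReal_le_ofReal
          (natCast_mul_exp_le (Fintype.card_pos_iff.2 ⟨s⟩).ne' hc.le)

theorem mainTheorem1 :
    ∃ c₁ K c : ℝ, 0 < c₁ ∧ 0 < K ∧ 0 < c ∧ ∃ n₀ : ℕ,
      ∀ (M : Type) (m : M) (V : Type) [Fintype V] (G : Digraph V) (s : V),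
        RadioNetwork.AllReachable G s → n₀ ≤ Fintype.card V →
        ∀ τ : ℕ,
          K * RadioNetwork.timeBound (Fintype.card V) (RadioNetwork.eccentricity G s) ≤ τ →
          (RadioNetwork.broadcast c₁ M).failureProb G s m τ ≤
            ENNReal.ofReal ((Fintype.card V : ℝ) ^ (-c)) := by
  obtain ⟨K, hK, h⟩ := mainTheorem1_general one_pos one_pos
  exact ⟨1, K, 1, one_pos, hK, one_pos, 0, fun M m V _ G s hreach _ => h M m V G s hreach⟩
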